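/- Fix $T>0$ and let $1\le p<\infty$. All functions are real valued and defined a.e. on $(0,T)$, and derivatives are weak derivatives unless stated otherwise. For $\alpha>0$ and $v\in L^1(0,T)$ put $$J^{\alpha}v(t)=\frac1{\Gamma(\alpha)}\int_0^t(t-s)^{\alpha-1}v(s)\,ds,\qquad 0<t<T.$$ The operator $J^\alpha$ is injective on $L^p(0,T)$; let $W_{\alpha,p}(0,T):=J^{\alpha}L^p(0,T)$ with the norm $\|u\|_{W_{\alpha,p}(0,T)}:=\|(J^{\alpha})^{-1}u\|_{L^p(0,T)}$. For an integer $k\ge0$ let $W^{k,p}(0,T)$ be the Sobolev space with norm $\|u\|_{W^{k,p}(0,T)}=\sum_{j=0}^k\big\|\frac{d^ju}{dt^j}\big\|_{L^p(0,T)}$. For $s=k+\theta$ with an integer $k\ge 0$ and $0<\theta<1$ let $W^{s,p}(0,T)$ be the space of all $u\in W^{k,p}(0,T)$ for which $$\|u\|_{W^{s,p}(0,T)}:=\Big(\|u\|_{W^{k,p}(0,T)}^p+\int_0^T\!\!\int_0^T\frac{\big|\frac{d^{k}u}{dt^{k}}(t)-\frac{d^{k}u}{dt^{k}}(s')\big|^p}{|t-s'|^{1+\theta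 p}}\,dt\,ds'\Big)^{1/p}<\infty .$$ For real $s\ge0$ let ${}_0W^{s,p}(0,T)$ be the closure in $W^{s,p}(0,T)$ of the set ${}_0C^{m}[0,T]$, $m=\lceil s\rceil$, of all $v\in C^{m}[0,T]$ with $\frac{d^kv}{dt^k}(0)=0$ (classical derivatives) for $0\le k\le m-1$. **Theorem 2.1.** Let $\alpha=m-1+\sigma$ with $m\in\mathbb N$, $m\ge1$, and $0<\sigma<1$, and let $0<\varepsilon<\alpha$. (i) There is a constant $C>0$, depending only on $\alpha$, $\varepsilon$ and $T$, such that for all $1\le p<\infty$ and all $v\in L^p(0,T)$ we have $J^{\alpha}v\in W^{\alpha-\varepsilon,p}(0,T)$ and $$\|J^{\alpha}v\|_{W^{\alpha-\varepsilon,p}(0,T)}\le C\|v\|_{L^p(0,T)} .$$ Moreover $W_{\alpha,p}(0,T)\subset{}_0W^{\alpha-\varepsilon,p}(0,T)$ for all $1\le p<\infty$. (ii) For all $1\le p<\infty$ we have ${}_0W^{\alpha+\varepsilon,p}(0,T)\subset W_{\alpha,p}(0,T)$, and for each $u\in{}_0W^{\alpha+\varepsilon,p}(0,T)$ the weak derivative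 $\frac{d^m}{dt^m}J^{m-\alpha}u$ exists, belongs to $L^p(0,T)$, and satisfies $$J^{\alpha}\Big(\frac{d^m}{dt^m}J^{m-\alpha}u\Big)(t)=u(t)\quad\text{for almost all } t\in(0,T).$$ (iii) For all $1\le p<\infty$ we have $W_{\alpha+\varepsilon,p}(0,T)\subset W_{\alpha,p}(0,T)$, and this embedding is compact: every sequence that is bounded in $W_{\alpha+\varepsilon,p}(0,T)$ has a subsequence that converges in $W_{\alpha,p}(0,T)$. -/

import Mathlib

open MeasureTheory Set Filter Topology
open scoped ENNReal NNReal

noncomputable section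

namespace FracSobolev

/-- Lebesgue measure on the interval `(0, T)`.  Functions on `(0, T)` are represented by functions
`ℝ → ℝ`; only their values almost everywhere on `(0, T)` matter. -/
def vol (T : ℝ) : Measure ℝ := volume.restrict (Ioo 0 T)

/-- The space `L^p(0,T)`. -/
def LpSpace (T p : ℝ) : Set (ℝ → ℝ) := {v | MemLp v (ENNReal.ofReal p) (vol T)}

/-- The `L^p(0,T)`-norm, with values in `[0, ∞]`. -/
def lpENorm (T p : ℝ) (v : ℝ → ℝ) : ℝ≥0∞ := eLpNorm v (ENNReal.ofReal p) (vol T)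

/-- The Riemann-Liouville fractional integral
`J^α v(t) = Γ(α)⁻¹ ∫₀ᵗ (t - s)^(α - 1) v(s) ds`.
For `α > 0` and `v ∈ L¹(0,T)` the integrand is integrable for almost every `t ∈ (0,T)`. -/
def J (α : ℝ) (v : ℝ → ℝ) (t : ℝ) : ℝ :=
  (Real.Gamma α)⁻¹ * ∫ s in Ioo 0 t, (t - s) ^ (α - 1) * v s

/-- `g` is a `k`-th weak (distributional) derivative of `u` on `(0, T)`. -/
def HasWeakDeriv (T : ℝ) (k : ℕ) (u g : ℝ → ℝ) : Prop :=
  LocallyIntegrableOn u (Ioo 0 T) ∧ LocallyIntegrableOn g (Ioo 0 T) ∧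
    ∀ φ : ℝ → ℝ, ContDiff ℝ (⊤ : ℕ∞) φ → HasCompactSupport φ → tsupport φ ⊆ Ioo 0 T →
      ∫ t in Ioo 0 T, u t * iteratedDeriv k φ t = (-1) ^ k * ∫ t in Ioo 0 T, g t * φ t

open Classical in
/-- The `k`-th weak derivative of `u` on `(0, T)`, which is unique up to null sets if it exists
(and `0` by convention if it does not exist). -/
def weakDeriv (T : ℝ) (k : ℕ) (u : ℝ → ℝ) : ℝ → ℝ :=
  if h : ∃ g, HasWeakDeriv T k u g then h.choose else 0

/-- The weak derivative `d^k u / dt^k` exists and belongs to `L^p(0,T)`. -/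
def WeakDerivInLp (T p : ℝ) (k : ℕ) (u : ℝ → ℝ) : Prop :=
  ∃ g, HasWeakDeriv T k u g ∧ g ∈ LpSpace T p

/-- The norm `∑_{j ≤ k} ‖d^j u / dt^j‖_{L^p(0,T)}` of `W^{k,p}(0,T)`, `k` a natural number. -/
def sobolevNorm (T p : ℝ) (k : ℕ) (u : ℝ → ℝ) : ℝ≥0∞ :=
  ∑ j ∈ Finset.range (k + 1), lpENorm T p (weakDeriv T j u)

/-- The double integral `∫₀ᵀ ∫₀ᵀ |w(t) - w(s)|^p / |t - s|^(1 + θ p) dt ds`. -/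
def gagliardo (T p θ : ℝ) (w : ℝ → ℝ) : ℝ≥0∞ :=
  ∫⁻ s in Ioo 0 T, ∫⁻ t in Ioo 0 T,
    ENNReal.ofReal (|w t - w s| ^ p / |t - s| ^ (1 + θ * p))

open Classical in
/-- The norm of the Sobolev-Slobodecki space `W^{s,p}(0,T)`, `s ≥ 0`, with values in `[0, ∞]`.
For `s = k + θ` with `k = ⌊s⌋` and `0 < θ < 1` its `p`-th power is the sum of the `p`-th power of
the `W^{k,p}`-norm and of the double integral of `d^k u / dt^k`; for an integer `s = k` it is the
`W^{k,p}`-norm. -/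
def slobodeckiNorm (T p s : ℝ) (u : ℝ → ℝ) : ℝ≥0∞ :=
  if s = (⌊s⌋₊ : ℝ) then sobolevNorm T p ⌊s⌋₊ u
  else (sobolevNorm T p ⌊s⌋₊ u ^ p +
    gagliardo T p (s - ⌊s⌋₊) (weakDeriv T ⌊s⌋₊ u)) ^ (1 / p)

/-- The Sobolev-Slobodecki space `W^{s,p}(0,T)`, `s ≥ 0`. -/
def W (T p s : ℝ) : Set (ℝ → ℝ) :=
  {u | u ∈ LpSpace T p ∧ (∀ j ≤ ⌊s⌋₊, WeakDerivInLp T p j u) ∧ slobodeckiNorm T p s u < ⊤}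

/-- The space `₀C^m[0,T]` of `C^m` functions on `[0,T]` whose derivatives of order
`0, ..., m - 1` vanish at `0`. -/
def zeroC (T : ℝ) (m : ℕ) : Set (ℝ → ℝ) :=
  {v | ContDiffOn ℝ m v (Icc 0 T) ∧ ∀ k < m, iteratedDerivWithin k v (Icc 0 T) 0 = 0}

/-- The space `₀W^{s,p}(0,T)`: the closure of `₀C^m[0,T]` in `W^{s,p}(0,T)`, where `m = ⌈s⌉`,
that is, `m - 1 < s < m` for non-integer `s`, and `m = s` for an integer `s`. -/
def zeroW (T p s : ℝ) : Set (ℝ → ℝ) :=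
  {u | u ∈ W T p s ∧
    ∀ δ : ℝ≥0∞, 0 < δ → ∃ v ∈ zeroC T ⌈s⌉₊, v ∈ W T p s ∧ slobodeckiNorm T p s (u - v) < δ}

/-- The space `W_{α,p}(0,T) = J^α L^p(0,T)`. -/
def fracW (T p α : ℝ) : Set (ℝ → ℝ) :=
  {u | ∃ w ∈ LpSpace T p, u =ᵐ[vol T] J α w}

open Classical in
/-- The inverse `(J^α)⁻¹ u ∈ L^p(0,T)` of `u ∈ W_{α,p}(0,T)` (and `0` by convention if `u` does not
belong to this space).  It is unique up to null sets, as `J^α` is injective on `L^p(0,T)`. -/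
def Jinv (T p α : ℝ) (u : ℝ → ℝ) : ℝ → ℝ :=
  if h : ∃ w ∈ LpSpace T p, u =ᵐ[vol T] J α w then h.choose else 0

/-- The norm `‖(J^α)⁻¹ u‖_{L^p(0,T)}` of `u ∈ W_{α,p}(0,T)`. -/
def fracNorm (T p α : ℝ) (u : ℝ → ℝ) : ℝ≥0∞ := lpENorm T p (Jinv T p α u)

/-- `W_{β,p}(0,T)` is contained in `W_{α,p}(0,T)` and the embedding is compact: every bounded
sequence in `W_{β,p}(0,T)` has a subsequence that converges in `W_{α,p}(0,T)`. -/
def CompactEmbedding (T p β α : ℝ) : Prop :=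
  fracW T p β ⊆ fracW T p α ∧
    ∀ u : ℕ → ℝ → ℝ, (∀ n, u n ∈ fracW T p β) →
      (∃ R : ℝ≥0, ∀ n, fracNorm T p β (u n) ≤ R) →
      ∃ v ∈ fracW T p α, ∃ n : ℕ → ℕ, StrictMono n ∧
        Tendsto (fun k => fracNorm T p α (u (n k) - v)) atTop (𝓝 0)

end FracSobolev

end

/-!
The whole argument takes place on the side of `L^p`.  Extend functions on `(0, T)` by zero; then
`J^β` is, on `(0, T)`, the convolution with the integrable kernel `x^(β - 1) / Γ(β)` cut off to
`(0, T)` (`J_eq_convolution`).  Young's inequality bounds it on `L^p` uniformly in `p`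
(`lpENorm_J_le`), and associativity of the convolution together with the Beta integral gives the
semigroup law `J^a J^b = J^(a + b)` (`J_J_ae`).  Since `D J^1 v = v` weakly, the semigroup law shows
`D^k J^(β + k) v = J^β v` and `D^k J^k v = v` (`hasWeakDeriv_J_add`, `hasWeakDeriv_J_nat`); the
latter also makes `J^a` injective (`J_injective`).

*Estimate (i).*  With `k = ⌊α - ε⌋` and `θ = α - ε - k` the top derivative of `J^α v` is
`J^(α - k) v = J^γ g`, where `θ < γ < 1` and `g = J^(α - k - γ) v ∈ L^p`.  The kernel of `J^γ` has `L^1`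
modulus of continuity `O(|h|^γ)` (`lintegral_fullKer_add_sub_le`), so Young's inequality bounds
the translates of `J^γ g`, and the double integral converges because `θ < γ` (`gagliardo_J_le`).
The inclusion in the closure follows by approximating `v` in `L^p` with smooth functions `φ` that
vanish near `0`: then `J^α φ` is smooth and vanishes near `0` (`fracW_subset_zeroW`).

*Part (ii).*  A function `v ∈ ₀C^⌈s⌉`, `s = α + ε`, satisfies `v = J^m v^(m) = J^α f` with
`f = J^(m - α) v^(m)`, and everything rests on the estimate `‖f‖_p ≤ C ‖v‖_{W^{s,p}}`
(`exists_lpENorm_fracDeriv_le`).  It is clear if `s ≥ m`.  If `s = m - 1 + θ` with `θ < 1`, put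
`w = v^(m - 1)`; Marchaud's formula (`J_derivWithin_eq`) writes `f`, up to the factor `1 / Γ(1 - σ)`,
as `t^(-σ) w(t) + σ ∫₀ᵗ (t - s)^(-σ - 1) (w(t) - w(s)) ds`. Jensen's inequality with the weight
`(t - s)^(θ - σ - 1)` bounds the integral by the double integral of order `θ > σ`.  The first term
needs a Hardy inequality (`exists_hardy`): `w` differs from its mean `A(t)` over `(0, t)` by at
most `t^θ` times the `1 / p`-th power of the inner double integral, and `A' = (w - A) / t` is
integrated from `0`, where `w` vanishes, if `θ p > 1`, and from `T` if `θ p < 1`; the value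
`θ p = 1` is avoided by lowering `θ`.  So the functions `f` belonging to a sequence that approximates `u`
converge in `L^p` to some `g`, and `u = J^α g` (`zeroW_subset_fracW`).  Then
`D^m J^(m - α) u = D^m J^m g = g`.

*Part (iii).*  By the semigroup law the embedding is `J^ε` on `L^p`.  Approximating its kernel in
`L^1` by continuous ones and using the Arzelà–Ascoli theorem for the latter shows that `J^ε` maps
bounded sets to totally bounded ones (`exists_finite_net_J`).
-/

noncomputable section

namespace FracSobolev


/-! ### Jensen's and Young's inequalities -/

/-- Jensen's inequality for the measure with density `k`. -/
lemma lintegral_mul_rpow_le {α : Type*} [MeasurableSpace α] {μ : Measure α} {p : ℝ} (hp : 1 ≤ p)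
    {k f : α → ℝ≥0∞} (hk : AEMeasurable k μ) (hf : AEMeasurable f μ) :
    (∫⁻ x, k x * f x ∂μ) ^ p ≤ (∫⁻ x, k x ∂μ) ^ (p - 1) * ∫⁻ x, k x * f x ^ p ∂μ := by
  rcases hp.eq_or_lt with rfl | hp1
  · simp
  have hpos : 0 < p := by linarith
  have hpq := Real.HolderConjugate.conjExponent hp1
  set q := p.conjExponent with hq
  have hq0 : 0 < q := hpq.symm.pos
  have h := ENNReal.lintegral_mul_le_Lp_mul_Lq μ hpq.symm (f := fun x => k x ^ (1 / q))
    (g := fun x => k x ^ (1 / p) * f x) (hk.pow_const _) ((hk.pow_const _).mul hf)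
  have e1 : ∀ x, ((fun x => k x ^ (1 / q)) * fun x => k x ^ (1 / p) * f x) x = k x * f x := by
    intro x
    simp only [Pi.mul_apply]
    rw [← mul_assoc, ← ENNReal.rpow_add_of_nonneg _ _ (by positivity) (by positivity)]
    have : 1 / q + 1 / p = 1 := by
      have := hpq.symm.inv_add_inv_eq_one
      simpa [one_div] using this
    rw [this, ENNReal.rpow_one]
  have e2 : ∀ x, (k x ^ (1 / q)) ^ q = k x := by
    intro x
    rw [← ENNReal.rpow_mul, one_div_mul_cancel hq0.ne', ENNReal.rpow_one]
  have e3 : ∀ x, (k x ^ (1 / p) * f x) ^ p = k x * f x ^ p := by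
    intro x
    rw [ENNReal.mul_rpow_of_nonneg _ _ hpos.le, ← ENNReal.rpow_mul, one_div_mul_cancel hpos.ne',
      ENNReal.rpow_one]
  simp only [e1, e2, e3] at h
  calc (∫⁻ x, k x * f x ∂μ) ^ p
      ≤ ((∫⁻ x, k x ∂μ) ^ (1 / q) * (∫⁻ x, k x * f x ^ p ∂μ) ^ (1 / p)) ^ p :=
        ENNReal.rpow_le_rpow h hpos.le
    _ = _ := by
        rw [ENNReal.mul_rpow_of_nonneg _ _ hpos.le, ← ENNReal.rpow_mul, ← ENNReal.rpow_mul,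
          one_div_mul_cancel hpos.ne', ENNReal.rpow_one]
        congr 2
        have := hpq.symm.inv_add_inv_eq_one
        field_simp at this ⊢
        linarith

/-- Young's inequality `‖k ⋆ f‖_p ≤ ‖k‖_1 ‖f‖_p`, raised to the power `p`. -/
lemma lintegral_convolution_rpow_le {p : ℝ} (hp : 1 ≤ p) {k f : ℝ → ℝ≥0∞} (hk : Measurable k)
    (hf : AEMeasurable f) :
    ∫⁻ t, (∫⁻ s, k (t - s) * f s) ^ p ≤ (∫⁻ x, k x) ^ p * ∫⁻ s, f s ^ p := by
  have hk' : ∀ t, ∫⁻ s, k (t - s) = ∫⁻ x, k x := fun t => lintegral_sub_left_eq_self k t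
  have hm : AEMeasurable (Function.uncurry fun t s : ℝ => k (t - s) * f s ^ p)
      (volume.prod volume) := by
    refine AEMeasurable.mul ?_ ?_
    · exact (hk.comp (measurable_fst.sub measurable_snd)).aemeasurable
    · exact (hf.pow_const p).comp_quasiMeasurePreserving Measure.quasiMeasurePreserving_snd
  calc ∫⁻ t, (∫⁻ s, k (t - s) * f s) ^ p
      ≤ ∫⁻ t, (∫⁻ x, k x) ^ (p - 1) * ∫⁻ s, k (t - s) * f s ^ p := by
        refine lintegral_mono fun t => ?_
        have := lintegral_mul_rpow_le hp (μ := volume) (k := fun s => k (t - s)) (f := f)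
          (hk.comp (measurable_const.sub measurable_id)).aemeasurable hf
        rwa [hk' t] at this
    _ = (∫⁻ x, k x) ^ (p - 1) * ∫⁻ t, ∫⁻ s, k (t - s) * f s ^ p :=
        lintegral_const_mul'' _ hm.lintegral_prod_right'
    _ = (∫⁻ x, k x) ^ (p - 1) * ((∫⁻ x, k x) * ∫⁻ s, f s ^ p) := by
        rw [lintegral_lintegral_swap hm]
        congr 1
        rw [← lintegral_const_mul'' _ (hf.pow_const p)]
        refine lintegral_congr fun s => ?_
        rw [lintegral_mul_const _ (by fun_prop)]
        congr 1
        exact lintegral_sub_right_eq_self k s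
    _ = _ := by
        rw [← mul_assoc]
        congr 1
        nth_rewrite 2 [← ENNReal.rpow_one (∫⁻ x, k x)]
        rw [← ENNReal.rpow_add_of_nonneg _ _ (by linarith) zero_le_one, sub_add_cancel]

/-! ### The fractional integral as a convolution -/

/-- The kernel of `J^β`, cut off to `(0, T)`; it is integrable on the line for `0 < β`. -/
def ker (T β : ℝ) : ℝ → ℝ := (Ioo 0 T).indicator fun x => (Real.Gamma β)⁻¹ * x ^ (β - 1)

/-- The extension of a function on `(0, T)` by zero. -/
def zext (T : ℝ) (v : ℝ → ℝ) : ℝ → ℝ := (Ioo 0 T).indicator v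

lemma measurable_ker (T β : ℝ) : Measurable (ker T β) := by
  unfold ker
  exact Measurable.indicator (by fun_prop) measurableSet_Ioo

lemma integrableOn_rpow_Ioo {T r : ℝ} (hr : -1 < r) :
    IntegrableOn (fun x : ℝ => x ^ r) (Ioo 0 T) := by
  rcases le_or_gt T 0 with hT | hT
  · simp [Ioo_eq_empty (not_lt.2 hT)]
  · exact (intervalIntegral.integrableOn_Ioo_rpow_iff hT).2 hr

lemma setIntegral_rpow_Ioo {T r : ℝ} (hT : 0 ≤ T) (hr : -1 < r) :
    ∫ x in Ioo 0 T, x ^ r = T ^ (r + 1) / (r + 1) := by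
  rw [← integral_Ioc_eq_integral_Ioo, ← intervalIntegral.integral_of_le hT,
    integral_rpow (Or.inl hr), Real.zero_rpow (by linarith), sub_zero]

lemma setLIntegral_rpow_Ioo {T r : ℝ} (hT : 0 ≤ T) (hr : -1 < r) :
    ∫⁻ x in Ioo 0 T, ENNReal.ofReal (x ^ r) = ENNReal.ofReal (T ^ (r + 1) / (r + 1)) := by
  rw [← setIntegral_rpow_Ioo hT hr, ofReal_integral_eq_lintegral_ofReal (integrableOn_rpow_Ioo hr)]
  filter_upwards [ae_restrict_mem measurableSet_Ioo] with x hx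
  exact Real.rpow_nonneg hx.1.le _

lemma integrable_ker {T β : ℝ} (hβ : 0 < β) : Integrable (ker T β) := by
  refine IntegrableOn.integrable_indicator ?_ measurableSet_Ioo
  exact (integrableOn_rpow_Ioo (by linarith)).const_mul _

lemma lintegral_enorm_ker {T β : ℝ} (hT : 0 ≤ T) (hβ : 0 < β) :
    ∫⁻ x, ‖ker T β x‖ₑ = ENNReal.ofReal (T ^ β / Real.Gamma (β + 1)) := by
  have hΓ := Real.Gamma_pos_of_pos hβ
  have h1 : ∀ x, ‖ker T β x‖ₑ = (Ioo 0 T).indicator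
      (fun x => ENNReal.ofReal (Real.Gamma β)⁻¹ * ENNReal.ofReal (x ^ (β - 1))) x := by
    intro x
    by_cases hx : x ∈ Ioo 0 T
    · have := Real.rpow_nonneg hx.1.le (β - 1)
      rw [ker, indicator_of_mem hx, indicator_of_mem hx, Real.enorm_of_nonneg (by positivity),
        ENNReal.ofReal_mul (by positivity)]
    · simp [ker, indicator_of_notMem hx]
  simp_rw [h1]
  rw [lintegral_indicator measurableSet_Ioo, lintegral_const_mul _ (by fun_prop),
    setLIntegral_rpow_Ioo hT (by linarith), ← ENNReal.ofReal_mul (by positivity), sub_add_cancel,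
    Real.Gamma_add_one hβ.ne']
  congr 1
  field_simp

lemma ker_mul_zext {T β : ℝ} {v : ℝ → ℝ} {t : ℝ} (ht : t ≤ T) (s : ℝ) :
    ker T β (t - s) * zext T v s =
      (Ioo 0 t).indicator (fun s => (Real.Gamma β)⁻¹ * ((t - s) ^ (β - 1) * v s)) s := by
  by_cases hs : s ∈ Ioo 0 t
  · have h1 : s ∈ Ioo 0 T := ⟨hs.1, hs.2.trans_le ht⟩
    have h2 : t - s ∈ Ioo 0 T := ⟨by linarith [hs.2], by linarith [hs.1]⟩
    rw [indicator_of_mem hs, ker, zext, indicator_of_mem h1, indicator_of_mem h2, mul_assoc]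
  · rw [indicator_of_notMem hs]
    by_cases h0 : 0 < s
    · have : ¬ (t - s ∈ Ioo 0 T) := fun h => hs ⟨h0, by linarith [h.1]⟩
      rw [ker, indicator_of_notMem this, zero_mul]
    · have : ¬ (s ∈ Ioo 0 T) := fun h => h0 h.1
      rw [zext, indicator_of_notMem this, mul_zero]

lemma J_eq_integral {T β : ℝ} {v : ℝ → ℝ} {t : ℝ} (ht : t ≤ T) :
    J β v t = ∫ s, ker T β (t - s) * zext T v s := by
  simp_rw [ker_mul_zext ht]
  rw [integral_indicator measurableSet_Ioo, integral_const_mul, J]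

lemma J_eq_convolution {T β : ℝ} {v : ℝ → ℝ} {t : ℝ} (ht : t ≤ T) :
    J β v t = convolution (zext T v) (ker T β) (ContinuousLinearMap.mul ℝ ℝ) volume t := by
  rw [J_eq_integral ht, convolution_def]
  exact integral_congr_ae (Eventually.of_forall fun s => mul_comm _ _)

lemma J_congr {T β : ℝ} {v w : ℝ → ℝ} (h : v =ᵐ[vol T] w) {t : ℝ} (ht : t ≤ T) :
    J β v t = J β w t := by
  unfold J
  congr 1
  refine integral_congr_ae ?_
  have h' := ae_restrict_of_ae_restrict_of_subset (Ioo_subset_Ioo_right ht) h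
  filter_upwards [h'] with s hs
  rw [hs]

lemma ae_vol_mem (T : ℝ) : ∀ᵐ t ∂(vol T), t ∈ Ioo 0 T := ae_restrict_mem measurableSet_Ioo

lemma J_congr_ae {T β : ℝ} {v w : ℝ → ℝ} (h : v =ᵐ[vol T] w) : J β v =ᵐ[vol T] J β w := by
  filter_upwards [ae_vol_mem T] with t ht using J_congr h ht.2.le

instance (T : ℝ) : IsFiniteMeasure (vol T) := by
  unfold vol; infer_instance

lemma integrable_zext {T : ℝ} {v : ℝ → ℝ} (hv : Integrable v (vol T)) : Integrable (zext T v) :=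
  IntegrableOn.integrable_indicator hv measurableSet_Ioo

lemma integrable_J {T β : ℝ} (hβ : 0 < β) {v : ℝ → ℝ} (hv : Integrable v (vol T)) :
    Integrable (J β v) (vol T) := by
  have h : Integrable (convolution (zext T v) (ker T β) (ContinuousLinearMap.mul ℝ ℝ) volume) :=
    (integrable_zext hv).integrable_convolution _ (integrable_ker hβ)
  refine (h.restrict (s := Ioo 0 T)).congr ?_
  filter_upwards [ae_vol_mem T] with t ht using (J_eq_convolution ht.2.le).symm

/-- The defining integral of `J^β v(t)` converges for almost every `t`. -/
lemma ae_integrable_J {T β : ℝ} (hβ : 0 < β) {v : ℝ → ℝ} (hv : Integrable v (vol T)) :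
    ∀ᵐ t ∂(vol T), Integrable (fun s => (t - s) ^ (β - 1) * v s) (volume.restrict (Ioo 0 t)) := by
  have h := (integrable_zext hv).ae_convolution_exists (ContinuousLinearMap.mul ℝ ℝ)
    (integrable_ker (T := T) hβ)
  filter_upwards [ae_restrict_of_ae h, ae_vol_mem T] with t h1 ht
  have h2 : Integrable (fun s => ker T β (t - s) * zext T v s) := by
    refine h1.congr (Eventually.of_forall fun s => ?_)
    simp [mul_comm]
  simp_rw [ker_mul_zext ht.2.le] at h2
  rw [integrable_indicator_iff measurableSet_Ioo] at h2
  have hΓ := (Real.Gamma_pos_of_pos hβ).ne'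
  refine (h2.const_mul (Real.Gamma β)).congr (Eventually.of_forall fun s => ?_)
  field_simp

lemma J_sub_ae {T β : ℝ} (hβ : 0 < β) {v w : ℝ → ℝ} (hv : Integrable v (vol T))
    (hw : Integrable w (vol T)) : J β (v - w) =ᵐ[vol T] J β v - J β w := by
  filter_upwards [ae_integrable_J hβ hv, ae_integrable_J hβ hw] with t h1 h2
  simp only [J, Pi.sub_apply, mul_sub]
  rw [integral_sub h1 h2, mul_sub]

/-! ### Norms -/

lemma one_le_ofReal {p : ℝ} (hp : 1 ≤ p) : 1 ≤ ENNReal.ofReal p := by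
  rwa [ENNReal.one_le_ofReal]

lemma integrable_of_mem {T p : ℝ} (hp : 1 ≤ p) {v : ℝ → ℝ} (hv : v ∈ LpSpace T p) :
    Integrable v (vol T) :=
  MemLp.integrable (one_le_ofReal hp) hv

lemma lpENorm_rpow {T p : ℝ} (hp : 1 ≤ p) (v : ℝ → ℝ) :
    lpENorm T p v ^ p = ∫⁻ t in Ioo 0 T, ‖v t‖ₑ ^ p := by
  have hp0 : 0 < p := by linarith
  rw [lpENorm, eLpNorm_eq_lintegral_rpow_enorm_toReal (by simpa using hp0) ENNReal.ofReal_ne_top,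
    ENNReal.toReal_ofReal hp0.le, ← ENNReal.rpow_mul, one_div_mul_cancel hp0.ne', ENNReal.rpow_one,
    vol]

lemma lintegral_zext_rpow {T p : ℝ} (hp : 1 ≤ p) (v : ℝ → ℝ) :
    ∫⁻ t, ‖zext T v t‖ₑ ^ p = lpENorm T p v ^ p := by
  rw [lpENorm_rpow hp, ← lintegral_indicator measurableSet_Ioo]
  refine lintegral_congr fun t => ?_
  by_cases ht : t ∈ Ioo 0 T
  · simp [zext, indicator_of_mem ht]
  · have : 0 < p := by linarith
    simp [zext, indicator_of_notMem ht, this]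

lemma lpENorm_convolution_le {T p : ℝ} (hp : 1 ≤ p) {k v : ℝ → ℝ} (hk : Measurable k)
    (hv : AEStronglyMeasurable v (vol T)) :
    lpENorm T p (fun t => ∫ s, k (t - s) * zext T v s) ≤ (∫⁻ x, ‖k x‖ₑ) * lpENorm T p v := by
  have hp0 : 0 < p := by linarith
  rw [← ENNReal.rpow_le_rpow_iff hp0, lpENorm_rpow hp, ENNReal.mul_rpow_of_nonneg _ _ hp0.le,
    ← lintegral_zext_rpow hp]
  have hz : AEStronglyMeasurable (zext T v) :=
    (aestronglyMeasurable_indicator_iff measurableSet_Ioo).2 hv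
  refine le_trans ?_ (lintegral_convolution_rpow_le hp (k := fun x => ‖k x‖ₑ)
    (f := fun s => ‖zext T v s‖ₑ) hk.enorm hz.enorm)
  refine (setLIntegral_le_lintegral _ _).trans (lintegral_mono fun t => ?_)
  refine ENNReal.rpow_le_rpow ((enorm_integral_le_lintegral_enorm _).trans_eq ?_) hp0.le
  simp [enorm_mul]

lemma lpENorm_congr {T p : ℝ} {v w : ℝ → ℝ} (h : v =ᵐ[vol T] w) :
    lpENorm T p v = lpENorm T p w := eLpNorm_congr_ae h

/-- `J^β` is bounded on `L^p(0,T)`, with a bound that does not depend on `p`. -/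
lemma lpENorm_J_le {T β p : ℝ} (hT : 0 ≤ T) (hβ : 0 < β) (hp : 1 ≤ p) {v : ℝ → ℝ}
    (hv : AEStronglyMeasurable v (vol T)) :
    lpENorm T p (J β v) ≤ ENNReal.ofReal (T ^ β / Real.Gamma (β + 1)) * lpENorm T p v := by
  rw [← lintegral_enorm_ker hT hβ]
  refine le_of_eq_of_le (lpENorm_congr ?_) (lpENorm_convolution_le hp (measurable_ker T β) hv)
  filter_upwards [ae_vol_mem T] with t ht using J_eq_integral ht.2.le

lemma J_mem {T β p : ℝ} (hT : 0 ≤ T) (hβ : 0 < β) (hp : 1 ≤ p) {v : ℝ → ℝ}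
    (hv : v ∈ LpSpace T p) : J β v ∈ LpSpace T p := by
  refine ⟨(integrable_J hβ (integrable_of_mem hp hv)).aestronglyMeasurable, ?_⟩
  exact (lpENorm_J_le hT hβ hp hv.1).trans_lt (ENNReal.mul_lt_top ENNReal.ofReal_lt_top hv.2)

/-! ### The semigroup law -/

lemma integral_rpow_mul_rpow {a b x : ℝ} (ha : 0 < a) (hb : 0 < b) (hx : 0 < x) :
    ∫ s in Ioo 0 x, s ^ (a - 1) * (x - s) ^ (b - 1) =
      x ^ (a + b - 1) * (Real.Gamma a * Real.Gamma b / Real.Gamma (a + b)) := by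
  have h := Complex.betaIntegral_scaled a b hx
  rw [Complex.betaIntegral_eq_Gamma_mul_div _ _ (by simpa using ha) (by simpa using hb)] at h
  rw [intervalIntegral.integral_of_le hx.le, integral_Ioc_eq_integral_Ioo] at h
  have h2 : ∫ s in Ioo 0 x, ((s : ℂ) ^ ((a : ℂ) - 1) * ((x : ℂ) - s) ^ ((b : ℂ) - 1)) =
      ∫ s in Ioo 0 x, (((s ^ (a - 1) * (x - s) ^ (b - 1) : ℝ)) : ℂ) := by
    refine setIntegral_congr_fun measurableSet_Ioo fun s hs => ?_
    push_cast
    rw [Complex.ofReal_cpow hs.1.le, Complex.ofReal_cpow (by linarith [hs.2])]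
    push_cast
    rfl
  rw [h2, integral_complex_ofReal] at h
  have h3 : ((x : ℂ) ^ ((a : ℂ) + b - 1)) = ((x ^ (a + b - 1) : ℝ) : ℂ) := by
    rw [Complex.ofReal_cpow hx.le]; push_cast; rfl
  rw [h3, ← Complex.ofReal_add, Complex.Gamma_ofReal, Complex.Gamma_ofReal,
    Complex.Gamma_ofReal] at h
  exact_mod_cast h

lemma ker_convolution_ker {T a b x : ℝ} (ha : 0 < a) (hb : 0 < b) (hx : x < T) :
    ∫ s, ker T a s * ker T b (x - s) = ker T (a + b) x := by
  rcases le_or_gt x 0 with h0 | h0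
  · have : ∀ s, ker T a s * ker T b (x - s) = 0 := by
      intro s
      by_cases hs : 0 < s
      · have : x - s ∉ Ioo 0 T := fun h => by linarith [h.1]
        rw [ker, ker, indicator_of_notMem this, mul_zero]
      · have : s ∉ Ioo 0 T := fun h => hs h.1
        rw [ker, indicator_of_notMem this, zero_mul]
    simp_rw [this]
    rw [ker, indicator_of_notMem (fun h => by linarith [h.1])]
    simp
  · have h1 : ∀ s, ker T a s * ker T b (x - s) = (Ioo 0 x).indicator (fun s =>
        ((Real.Gamma a)⁻¹ * (Real.Gamma b)⁻¹) * (s ^ (a - 1) * (x - s) ^ (b - 1))) s := by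
      intro s
      by_cases hs : s ∈ Ioo 0 x
      · have h1 : s ∈ Ioo 0 T := ⟨hs.1, hs.2.trans hx⟩
        have h2 : x - s ∈ Ioo 0 T := ⟨by linarith [hs.2], by linarith [hs.1]⟩
        rw [indicator_of_mem hs, ker, ker, indicator_of_mem h1, indicator_of_mem h2]
        ring
      · rw [indicator_of_notMem hs]
        by_cases h0 : 0 < s
        · have : x - s ∉ Ioo 0 T := fun h => hs ⟨h0, by linarith [h.1]⟩
          rw [ker, ker, indicator_of_notMem this, mul_zero]
        · have : s ∉ Ioo 0 T := fun h => h0 h.1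
          rw [ker, indicator_of_notMem this, zero_mul]
    simp_rw [h1]
    rw [integral_indicator measurableSet_Ioo, integral_const_mul, integral_rpow_mul_rpow ha hb h0,
      ker, indicator_of_mem (show x ∈ Ioo 0 T from ⟨h0, hx⟩)]
    have := (Real.Gamma_pos_of_pos ha).ne'
    have := (Real.Gamma_pos_of_pos hb).ne'
    field_simp

/-- The semigroup law `J^a J^b = J^(a + b)`. -/
lemma J_J_ae {T a b : ℝ} (ha : 0 < a) (hb : 0 < b) {v : ℝ → ℝ} (hv : Integrable v (vol T)) :
    J a (J b v) =ᵐ[vol T] J (a + b) v := by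
  set L := ContinuousLinearMap.mul ℝ ℝ
  have hz := integrable_zext hv
  have hka := integrable_ker (T := T) ha
  have hkb := integrable_ker (T := T) hb
  have hex : ∀ᵐ x, ConvolutionExistsAt (fun x => ‖zext T v x‖)
      (convolution (fun x => ‖ker T b x‖) (fun x => ‖ker T a x‖) L volume) x L volume :=
    hz.norm.ae_convolution_exists _ (hkb.norm.integrable_convolution _ hka.norm)
  filter_upwards [ae_restrict_of_ae hex, ae_vol_mem T] with t h1 ht
  have hassoc := convolution_assoc (f := zext T v) (g := ker T b) (k := ker T a)
    (μ := volume) (ν := volume) L L L L (fun x y z => mul_assoc x y z) (x₀ := t)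
    hz.aestronglyMeasurable hkb.aestronglyMeasurable hka.aestronglyMeasurable
    (hz.ae_convolution_exists _ hkb) (hkb.norm.ae_convolution_exists _ hka.norm) h1
  have e1 : J a (J b v) t = convolution (convolution (zext T v) (ker T b) L volume) (ker T a) L
      volume t := by
    rw [J_eq_convolution ht.2.le, convolution_def, convolution_def]
    refine integral_congr_ae (Eventually.of_forall fun s => ?_)
    simp only [L, ContinuousLinearMap.mul_apply']
    by_cases hs : s ∈ Ioo 0 T
    · rw [zext, indicator_of_mem hs, J_eq_convolution hs.2.le]
    · rw [zext, indicator_of_notMem hs, zero_mul]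
      by_cases hs0 : 0 < s
      · have hsT : T ≤ s := not_lt.1 fun h => hs ⟨hs0, h⟩
        have : t - s ∉ Ioo 0 T := fun h => by linarith [h.1, ht.2]
        rw [ker, ker, indicator_of_notMem this, mul_zero]
      · have : s ≤ T := by linarith [ht.1, ht.2]
        rw [← J_eq_convolution this, J, Ioo_eq_empty hs0]
        simp
  have e2 : J (a + b) v t = convolution (zext T v) (convolution (ker T b) (ker T a) L volume) L
      volume t := by
    rw [J_eq_convolution ht.2.le, convolution_def, convolution_def]
    refine integral_congr_ae (Eventually.of_forall fun s => ?_)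
    simp only [L, ContinuousLinearMap.mul_apply']
    by_cases hs : s ∈ Ioo 0 T
    · rw [convolution_def]
      simp only [ContinuousLinearMap.mul_apply']
      rw [ker_convolution_ker hb ha (by linarith [hs.1, ht.2]), add_comm]
    · rw [zext, indicator_of_notMem hs, zero_mul, zero_mul]
  rw [e1, e2, hassoc]


/-! ### Weak derivatives -/

/-- A test function on `(0, T)`: smooth on the line with compact support inside `(0, T)`. -/
structure IsTest (T : ℝ) (φ : ℝ → ℝ) : Prop where
  smooth : ContDiff ℝ (⊤ : ℕ∞) φ
  compact : HasCompactSupport φ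
  supp : tsupport φ ⊆ Ioo 0 T

lemma IsTest.deriv {T : ℝ} {φ : ℝ → ℝ} (h : IsTest T φ) : IsTest T (deriv φ) where
  smooth := h.smooth.iterate_deriv 1
  compact := h.compact.deriv
  supp := tsupport_deriv_subset.trans h.supp

lemma IsTest.iteratedDeriv {T : ℝ} {φ : ℝ → ℝ} (h : IsTest T φ) (k : ℕ) :
    IsTest T (iteratedDeriv k φ) := by
  induction k with
  | zero => simpa using h
  | succ k ih => rw [iteratedDeriv_succ]; exact ih.deriv

lemma IsTest.integrable_mul {T : ℝ} {φ : ℝ → ℝ} (h : IsTest T φ) {u : ℝ → ℝ}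
    (hu : LocallyIntegrableOn u (Ioo 0 T)) : Integrable (fun t => u t * φ t) := by
  have h1 : IntegrableOn u (tsupport φ) := hu.integrableOn_compact_subset h.supp h.compact
  have h2 := h1.mul_continuousOn h.smooth.continuous.continuousOn h.compact
  refine (integrableOn_iff_integrable_of_support_subset ?_).1 h2
  intro x hx
  exact subset_tsupport φ fun h0 => hx (by simp [h0])

lemma IsTest.eq_zero {T : ℝ} {φ : ℝ → ℝ} (h : IsTest T φ) {t : ℝ} (ht : t ∉ Ioo 0 T) :
    φ t = 0 := image_eq_zero_of_notMem_tsupport fun h' => ht (h.supp h')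

lemma locallyIntegrableOn_of_integrable {T : ℝ} {v : ℝ → ℝ} (hv : Integrable v (vol T)) :
    LocallyIntegrableOn v (Ioo 0 T) := IntegrableOn.locallyIntegrableOn hv

lemma locallyIntegrableOn_congr {T : ℝ} {u v : ℝ → ℝ} (h : u =ᵐ[vol T] v)
    (hu : LocallyIntegrableOn u (Ioo 0 T)) : LocallyIntegrableOn v (Ioo 0 T) := by
  rw [locallyIntegrableOn_iff isOpen_Ioo.isLocallyClosed] at hu ⊢
  intro K hK hKc
  exact (hu K hK hKc).congr (ae_restrict_of_ae_restrict_of_subset hK h)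

lemma HasWeakDeriv.congr {T : ℝ} {k : ℕ} {u u' g g' : ℝ → ℝ} (h : HasWeakDeriv T k u g)
    (hu : u =ᵐ[vol T] u') (hg : g =ᵐ[vol T] g') : HasWeakDeriv T k u' g' := by
  refine ⟨locallyIntegrableOn_congr hu h.1, locallyIntegrableOn_congr hg h.2.1, ?_⟩
  intro φ h1 h2 h3
  have e1 : ∫ t in Ioo 0 T, u' t * iteratedDeriv k φ t =
      ∫ t in Ioo 0 T, u t * iteratedDeriv k φ t := by
    refine integral_congr_ae ?_
    filter_upwards [hu] with t ht
    rw [ht]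
  have e2 : ∫ t in Ioo 0 T, g' t * φ t = ∫ t in Ioo 0 T, g t * φ t := by
    refine integral_congr_ae ?_
    filter_upwards [hg] with t ht
    rw [ht]
  rw [e1, e2, h.2.2 φ h1 h2 h3]

lemma HasWeakDeriv.sub {T : ℝ} {k : ℕ} {u u' g g' : ℝ → ℝ} (h : HasWeakDeriv T k u g)
    (h' : HasWeakDeriv T k u' g') : HasWeakDeriv T k (u - u') (g - g') := by
  refine ⟨h.1.sub h'.1, h.2.1.sub h'.2.1, ?_⟩
  intro φ h1 h2 h3
  have hφ : IsTest T φ := ⟨h1, h2, h3⟩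
  simp only [Pi.sub_apply, sub_mul]
  rw [integral_sub ((hφ.iteratedDeriv k).integrable_mul h.1).restrict
    ((hφ.iteratedDeriv k).integrable_mul h'.1).restrict,
    integral_sub (hφ.integrable_mul h.2.1).restrict (hφ.integrable_mul h'.2.1).restrict,
    h.2.2 φ h1 h2 h3, h'.2.2 φ h1 h2 h3]
  ring

lemma HasWeakDeriv.unique {T : ℝ} {k : ℕ} {u g g' : ℝ → ℝ} (h : HasWeakDeriv T k u g)
    (h' : HasWeakDeriv T k u g') : g =ᵐ[vol T] g' := by
  have h0 := h.sub h'
  have := isOpen_Ioo.ae_eq_zero_of_integral_contDiff_smul_eq_zero (μ := volume) h0.2.1 (by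
    intro φ h1 h2 h3
    have h4 := h0.2.2 φ h1 h2 h3
    simp only [sub_self, Pi.zero_apply, zero_mul, integral_zero] at h4
    have h5 : ∫ t in Ioo 0 T, (g - g') t * φ t = 0 :=
      (mul_eq_zero.1 h4.symm).resolve_left (pow_ne_zero _ (by norm_num))
    rw [← h5, setIntegral_eq_integral_of_forall_compl_eq_zero]
    · exact integral_congr_ae (Eventually.of_forall fun t => by simp [mul_comm])
    · intro t ht
      rw [(⟨h1, h2, h3⟩ : IsTest T φ).eq_zero ht, mul_zero])
  rw [vol, Filter.EventuallyEq, ae_restrict_iff' measurableSet_Ioo]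
  filter_upwards [this] with t ht hmem
  exact sub_eq_zero.1 (ht hmem)

lemma HasWeakDeriv.weakDeriv_ae {T : ℝ} {k : ℕ} {u g : ℝ → ℝ} (h : HasWeakDeriv T k u g) :
    weakDeriv T k u =ᵐ[vol T] g := by
  have hex : ∃ g, HasWeakDeriv T k u g := ⟨g, h⟩
  rw [weakDeriv, dif_pos hex]
  exact hex.choose_spec.unique h

lemma hasWeakDeriv_zero {T : ℝ} {u : ℝ → ℝ} (hu : Integrable u (vol T)) :
    HasWeakDeriv T 0 u u :=
  ⟨locallyIntegrableOn_of_integrable hu, locallyIntegrableOn_of_integrable hu, by simp⟩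

lemma J_one (v : ℝ → ℝ) (t : ℝ) : J 1 v t = ∫ s in Ioo 0 t, v s := by
  simp [J]

lemma IsTest.integral_deriv {T : ℝ} {φ : ℝ → ℝ} (h : IsTest T φ) {s : ℝ} (hs : s ≤ T) :
    ∫ t in Ioo s T, _root_.deriv φ t = -φ s := by
  rw [← integral_Ioc_eq_integral_Ioo, ← intervalIntegral.integral_of_le hs,
    intervalIntegral.integral_deriv_of_contDiffOn_Icc
      (h.smooth.of_le (by exact_mod_cast le_top)).contDiffOn hs,
    h.eq_zero (t := T) (by simp), zero_sub]

/-- Integration by parts against a test function for the primitive `J^1 u`. -/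
lemma integral_J_one_mul_deriv {T : ℝ} {u φ : ℝ → ℝ} (hu : Integrable u (vol T))
    (hφ : IsTest T φ) :
    ∫ t in Ioo 0 T, J 1 u t * deriv φ t = -∫ t in Ioo 0 T, u t * φ t := by
  have hφi : Integrable (deriv φ) (vol T) :=
    (hφ.deriv.smooth.continuous.integrable_of_hasCompactSupport hφ.deriv.compact).restrict
  have hS : MeasurableSet {z : ℝ × ℝ | z.2 < z.1} := measurableSet_lt measurable_snd measurable_fst
  have hint : Integrable (Function.uncurry fun t s : ℝ =>
      {z : ℝ × ℝ | z.2 < z.1}.indicator (fun z => deriv φ z.1 * u z.2) (t, s))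
      ((vol T).prod (vol T)) := (hφi.mul_prod hu).indicator hS
  calc ∫ t in Ioo 0 T, J 1 u t * deriv φ t
      = ∫ t, (∫ s, {z : ℝ × ℝ | z.2 < z.1}.indicator (fun z => deriv φ z.1 * u z.2) (t, s) ∂(vol T))
          ∂(vol T) := by
        refine setIntegral_congr_fun measurableSet_Ioo fun t ht => ?_
        have : ∀ s, {z : ℝ × ℝ | z.2 < z.1}.indicator (fun z => deriv φ z.1 * u z.2) (t, s) =
            (Iio t).indicator (fun s => deriv φ t * u s) s := fun s => by
          simp [indicator]
        simp_rw [this]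
        rw [integral_indicator measurableSet_Iio, integral_const_mul, J_one, mul_comm, vol,
          Measure.restrict_restrict measurableSet_Iio]
        congr 3
        ext s
        simp only [mem_Ioo, mem_inter_iff, mem_Iio]
        exact ⟨fun h => ⟨h.2, h.1, h.2.trans ht.2⟩, fun h => ⟨h.2.1, h.1⟩⟩
    _ = ∫ s, (∫ t, {z : ℝ × ℝ | z.2 < z.1}.indicator (fun z => deriv φ z.1 * u z.2) (t, s) ∂(vol T))
          ∂(vol T) := integral_integral_swap hint
    _ = ∫ s in Ioo 0 T, -(u s * φ s) := by
        refine setIntegral_congr_fun measurableSet_Ioo fun s hs => ?_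
        have : ∀ t, {z : ℝ × ℝ | z.2 < z.1}.indicator (fun z => deriv φ z.1 * u z.2) (t, s) =
            (Ioi s).indicator (fun t => deriv φ t * u s) t := fun t => by
          simp [indicator]
        simp_rw [this]
        rw [integral_indicator measurableSet_Ioi, integral_mul_const, vol,
          Measure.restrict_restrict measurableSet_Ioi]
        have hset : Ioi s ∩ Ioo 0 T = Ioo s T := by
          ext t
          simp only [mem_Ioo, mem_inter_iff, mem_Ioi]
          exact ⟨fun h => ⟨h.1, h.2.2⟩, fun h => ⟨h.1, hs.1.trans h.1, h.2⟩⟩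
        rw [hset, hφ.integral_deriv hs.2.le]
        ring
    _ = _ := integral_neg _

lemma HasWeakDeriv.J_one {T : ℝ} {k : ℕ} {u g : ℝ → ℝ} (h : HasWeakDeriv T k u g)
    (hu : Integrable u (vol T)) : HasWeakDeriv T (k + 1) (J 1 u) g := by
  refine ⟨locallyIntegrableOn_of_integrable (integrable_J one_pos hu), h.2.1, ?_⟩
  intro φ h1 h2 h3
  have hφ : IsTest T φ := ⟨h1, h2, h3⟩
  rw [iteratedDeriv_succ, integral_J_one_mul_deriv hu (hφ.iteratedDeriv k), h.2.2 φ h1 h2 h3]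
  ring

/-- The `k`-th weak derivative of `J^(β + k) v` is `J^β v`. -/
lemma hasWeakDeriv_J_add {T β : ℝ} (hβ : 0 < β) {v : ℝ → ℝ} (hv : Integrable v (vol T)) (k : ℕ) :
    HasWeakDeriv T k (J (β + k) v) (J β v) := by
  induction k with
  | zero => simpa using hasWeakDeriv_zero (integrable_J hβ hv)
  | succ k ih =>
    refine (ih.J_one (integrable_J (by positivity) hv)).congr ?_ (ae_eq_refl _)
    have := J_J_ae (T := T) one_pos (show 0 < β + k by positivity) hv
    rwa [show 1 + (β + k) = β + (k + 1 : ℕ) by push_cast; ring] at this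

/-- The `k`-th weak derivative of `J^k v` is `v`. -/
lemma hasWeakDeriv_J_nat {T : ℝ} {v : ℝ → ℝ} (hv : Integrable v (vol T)) {k : ℕ} (hk : 1 ≤ k) :
    HasWeakDeriv T k (J k v) v := by
  induction k, hk using Nat.le_induction with
  | base => simpa using (hasWeakDeriv_zero hv).J_one hv
  | succ k hk ih =>
    have hk0 : (0 : ℝ) < k := by exact_mod_cast hk
    refine (ih.J_one (integrable_J hk0 hv)).congr ?_ (ae_eq_refl _)
    have := J_J_ae (T := T) one_pos hk0 hv
    rwa [show 1 + (k : ℝ) = (k + 1 : ℕ) by push_cast; ring] at this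

lemma J_zero_fun (β : ℝ) : J β 0 = 0 := by
  ext t; simp [J]

/-- `J^a` is injective: `h` is a derivative of `J^N h = J^(N-a) J^a h` for `N > a`. -/
lemma ae_eq_zero_of_J_ae_eq_zero {T a : ℝ} (ha : 0 < a) {h : ℝ → ℝ} (hh : Integrable h (vol T))
    (h0 : J a h =ᵐ[vol T] 0) : h =ᵐ[vol T] 0 := by
  obtain ⟨N, hN⟩ := exists_nat_gt a
  have hN1 : 1 ≤ N := by
    have : (0 : ℝ) < N := ha.trans hN
    exact_mod_cast this
  have h1 : J N h =ᵐ[vol T] 0 := by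
    have h2 := J_J_ae (T := T) (sub_pos.2 hN) ha hh
    rw [sub_add_cancel] at h2
    have h3 := J_congr_ae (β := (N : ℝ) - a) h0
    rw [J_zero_fun] at h3
    exact h2.symm.trans h3
  have h2 := (hasWeakDeriv_J_nat hh hN1).congr h1 (ae_eq_refl _)
  have h3 : HasWeakDeriv T N (0 : ℝ → ℝ) 0 := by
    simpa using h2.sub h2
  exact h2.unique h3

lemma J_injective {T a : ℝ} (ha : 0 < a) {v w : ℝ → ℝ} (hv : Integrable v (vol T))
    (hw : Integrable w (vol T)) (h : J a v =ᵐ[vol T] J a w) : v =ᵐ[vol T] w := by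
  have h1 : J a (v - w) =ᵐ[vol T] 0 := by
    filter_upwards [J_sub_ae ha hv hw, h] with t h2 h3
    rw [h2, Pi.sub_apply, h3, sub_self, Pi.zero_apply]
  filter_upwards [ae_eq_zero_of_J_ae_eq_zero ha (hv.sub hw) h1] with t ht
  exact sub_eq_zero.1 ht

lemma Jinv_ae {T p a : ℝ} (hp : 1 ≤ p) (ha : 0 < a) {u w : ℝ → ℝ} (hw : w ∈ LpSpace T p)
    (h : u =ᵐ[vol T] J a w) : Jinv T p a u =ᵐ[vol T] w := by
  have hex : ∃ w ∈ LpSpace T p, u =ᵐ[vol T] J a w := ⟨w, hw, h⟩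
  rw [Jinv, dif_pos hex]
  obtain ⟨h1, h2⟩ := hex.choose_spec
  exact J_injective ha (integrable_of_mem hp h1) (integrable_of_mem hp hw) (h2.symm.trans h)


/-! ### Translates of the kernel -/

/-- The kernel `x₊^(γ - 1) / Γ(γ)` of `J^γ` on the whole line. -/
def fullKer (γ : ℝ) : ℝ → ℝ := (Ioi 0).indicator fun x => (Real.Gamma γ)⁻¹ * x ^ (γ - 1)

lemma measurable_fullKer (γ : ℝ) : Measurable (fullKer γ) := by
  unfold fullKer
  exact Measurable.indicator (by fun_prop) measurableSet_Ioi

lemma fullKer_mul_zext {T γ : ℝ} {v : ℝ → ℝ} {t : ℝ} (ht : t ≤ T) (s : ℝ) :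
    fullKer γ (t - s) * zext T v s = ker T γ (t - s) * zext T v s := by
  by_cases hs : s ∈ Ioo 0 T
  · congr 1
    by_cases h : 0 < t - s
    · rw [fullKer, ker, indicator_of_mem (show t - s ∈ Ioi 0 from h),
        indicator_of_mem (show t - s ∈ Ioo 0 T from ⟨h, by linarith [hs.1]⟩)]
    · rw [fullKer, ker, indicator_of_notMem (show t - s ∉ Ioi 0 from h),
        indicator_of_notMem fun h' => h h'.1]
  · simp [zext, indicator_of_notMem hs]

lemma intervalIntegrable_rpow_add {γ h a b : ℝ} (hγ : 0 < γ) :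
    IntervalIntegrable (fun x : ℝ => (x + h) ^ (γ - 1)) volume a b := by
  have := (intervalIntegral.intervalIntegrable_rpow' (a := a + h) (b := b + h)
    (r := γ - 1) (by linarith)).comp_add_right h
  simpa using this

lemma setLIntegral_rpow_sub_le {γ h : ℝ} (hγ0 : 0 < γ) (hγ1 : γ < 1) (hh : 0 < h) {R : ℝ}
    (hR : 0 ≤ R) :
    ∫⁻ x in Ioo 0 R, ENNReal.ofReal (x ^ (γ - 1) - (x + h) ^ (γ - 1)) ≤
      ENNReal.ofReal (h ^ γ / γ) := by
  have hi1 : IntervalIntegrable (fun x : ℝ => x ^ (γ - 1)) volume 0 R :=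
    intervalIntegral.intervalIntegrable_rpow' (by linarith)
  have hi2 : IntervalIntegrable (fun x : ℝ => (x + h) ^ (γ - 1)) volume 0 R :=
    intervalIntegrable_rpow_add hγ0
  have hi := (intervalIntegrable_iff_integrableOn_Ioo_of_le hR).1 (hi1.sub hi2)
  rw [← ofReal_integral_eq_lintegral_ofReal hi]
  · apply ENNReal.ofReal_le_ofReal
    rw [← integral_Ioc_eq_integral_Ioo, ← intervalIntegral.integral_of_le hR,
      intervalIntegral.integral_sub hi1 hi2,
      intervalIntegral.integral_comp_add_right (fun x => x ^ (γ - 1)),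
      integral_rpow (Or.inl (by linarith)), integral_rpow (Or.inl (by linarith))]
    simp only [sub_add_cancel, zero_add]
    rw [Real.zero_rpow hγ0.ne']
    have : R ^ γ ≤ (R + h) ^ γ := Real.rpow_le_rpow hR (by linarith) hγ0.le
    rw [← sub_div]
    gcongr
    linarith
  · filter_upwards [ae_restrict_mem measurableSet_Ioo] with x hx
    have := Real.rpow_le_rpow_of_nonpos hx.1 (show x ≤ x + h by linarith)
      (show γ - 1 ≤ 0 by linarith)
    simpa using this

lemma lintegral_fullKer_add_sub_le_of_pos {γ h : ℝ} (hγ0 : 0 < γ) (hγ1 : γ < 1) (hh : 0 < h) :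
    ∫⁻ x, ‖fullKer γ (x + h) - fullKer γ x‖ₑ ≤
      ENNReal.ofReal (2 / Real.Gamma (γ + 1) * h ^ γ) := by
  have hΓ := Real.Gamma_pos_of_pos hγ0
  set c := ENNReal.ofReal (Real.Gamma γ)⁻¹ with hc
  -- On `(-h, 0]` only the translate contributes; on `(0, ∞)` the kernel decreases.
  have hpt : ∀ x, ‖fullKer γ (x + h) - fullKer γ x‖ₑ ≤
      (Ioo 0 h).indicator (fun y => c * ENNReal.ofReal (y ^ (γ - 1))) (x + h) +
      ({h} : Set ℝ).indicator (fun _ => (∞ : ℝ≥0∞)) (x + h) +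
      (Ioi 0).indicator (fun x => c * ENNReal.ofReal (x ^ (γ - 1) - (x + h) ^ (γ - 1))) x := by
    intro x
    rcases lt_trichotomy x 0 with hx | rfl | hx
    · have h0 : fullKer γ x = 0 := indicator_of_notMem (fun h' : 0 < x => hx.not_gt h') _
      rw [h0, sub_zero]
      by_cases hxh : 0 < x + h
      · have h1 : x + h ∈ Ioo 0 h := ⟨hxh, by linarith⟩
        rw [indicator_of_mem h1, fullKer, indicator_of_mem (show x + h ∈ Ioi 0 from hxh),
          add_assoc]
        refine le_add_right (le_of_eq ?_)
        have := Real.rpow_nonneg hxh.le (γ - 1)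
        rw [Real.enorm_of_nonneg (by positivity), ENNReal.ofReal_mul (by positivity)]
      · rw [fullKer, indicator_of_notMem (show x + h ∉ Ioi 0 from hxh)]
        simp
    · simp
    · rw [indicator_of_mem (show x ∈ Ioi 0 from hx)]
      refine le_add_left (le_of_eq ?_)
      rw [fullKer, indicator_of_mem (show x + h ∈ Ioi 0 from by simp; linarith),
        indicator_of_mem (show x ∈ Ioi 0 from hx), ← mul_sub, enorm_mul,
        Real.enorm_of_nonneg (by positivity), enorm_sub_rev, Real.enorm_of_nonneg]
      have := Real.rpow_le_rpow_of_nonpos hx (show x ≤ x + h by linarith)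
        (show γ - 1 ≤ 0 by linarith)
      linarith
  have hm1 : Measurable ((Ioo 0 h).indicator
      (fun y : ℝ => c * ENNReal.ofReal (y ^ (γ - 1)))) :=
    Measurable.indicator (by fun_prop) measurableSet_Ioo
  have hm2 : Measurable (({h} : Set ℝ).indicator (fun _ => (∞ : ℝ≥0∞))) :=
    Measurable.indicator measurable_const (measurableSet_singleton h)
  refine (lintegral_mono hpt).trans ?_
  rw [lintegral_add_left (by fun_prop), lintegral_add_left (by fun_prop),
    lintegral_add_right_eq_self (fun y => (Ioo 0 h).indicator
      (fun y : ℝ => c * ENNReal.ofReal (y ^ (γ - 1))) y) h,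
    lintegral_add_right_eq_self (fun y => ({h} : Set ℝ).indicator (fun _ => (∞ : ℝ≥0∞)) y) h,
    lintegral_indicator measurableSet_Ioo, lintegral_indicator (measurableSet_singleton h),
    lintegral_indicator measurableSet_Ioi, lintegral_const_mul _ (by fun_prop),
    lintegral_const_mul _ (by fun_prop), setLIntegral_rpow_Ioo hh.le (by linarith)]
  have hU : ⋃ n : ℕ, Ioo (0 : ℝ) n = Ioi 0 := by
    ext x
    simp only [mem_iUnion, mem_Ioo, mem_Ioi]
    exact ⟨fun ⟨_, h⟩ => h.1, fun h => let ⟨n, hn⟩ := exists_nat_gt x; ⟨n, h, hn⟩⟩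
  have hB : ∫⁻ x in Ioi 0, ENNReal.ofReal (x ^ (γ - 1) - (x + h) ^ (γ - 1)) ≤
      ENNReal.ofReal (h ^ γ / γ) := by
    rw [← hU, setLIntegral_iUnion_of_directed]
    · exact iSup_le fun n => setLIntegral_rpow_sub_le hγ0 hγ1 hh n.cast_nonneg
    · exact (monotone_nat_of_le_succ fun n => Ioo_subset_Ioo_right (by simp)).directed_le
  simp only [sub_add_cancel, lintegral_const, Measure.restrict_apply MeasurableSet.univ, univ_inter,
    Real.volume_singleton, mul_zero, add_zero]
  refine (add_le_add_right (mul_le_mul_right hB c) _).trans (le_of_eq ?_)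
  have := Real.rpow_nonneg hh.le γ
  rw [← mul_add, ← ENNReal.ofReal_add (by positivity) (by positivity),
    ← ENNReal.ofReal_mul (by positivity), Real.Gamma_add_one hγ0.ne']
  congr 1
  field_simp
  ring

/-- The `L^1` modulus of continuity of the kernel of `J^γ`. -/
lemma lintegral_fullKer_add_sub_le {γ : ℝ} (hγ0 : 0 < γ) (hγ1 : γ < 1) (h : ℝ) :
    ∫⁻ x, ‖fullKer γ (x + h) - fullKer γ x‖ₑ ≤
      ENNReal.ofReal (2 / Real.Gamma (γ + 1) * |h| ^ γ) := by
  rcases lt_trichotomy h 0 with hh | rfl | hh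
  · have := lintegral_fullKer_add_sub_le_of_pos hγ0 hγ1 (neg_pos.2 hh)
    rw [abs_of_neg hh]
    refine le_of_eq_of_le ?_ this
    rw [← lintegral_add_right_eq_self (fun x => ‖fullKer γ (x + -h) - fullKer γ x‖ₑ) h]
    refine lintegral_congr fun x => ?_
    rw [add_neg_cancel_right, enorm_sub_rev]
  · simp
  · rw [abs_of_pos hh]
    exact lintegral_fullKer_add_sub_le_of_pos hγ0 hγ1 hh

/-! ### The double integral of a fractional integral -/

lemma lintegral_comp_abs {F : ℝ → ℝ≥0∞} (hF : Measurable F) :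
    ∫⁻ x, F |x| = 2 * ∫⁻ x in Ioi 0, F x := by
  have hm : Measurable ((Ioi (0 : ℝ)).indicator F) := hF.indicator measurableSet_Ioi
  have h1 : ∀ᵐ x : ℝ, F |x| = (Ioi 0).indicator F x + (Ioi 0).indicator F (-x) := by
    filter_upwards [compl_mem_ae_iff.2 (measure_singleton (0 : ℝ))] with x hx
    rcases lt_or_gt_of_ne (show x ≠ 0 from hx) with h | h
    · simp [indicator, h, h.not_gt, abs_of_neg h]
    · simp [indicator, h, h.not_gt, abs_of_pos h]
  rw [lintegral_congr_ae h1, lintegral_add_left hm,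
    lintegral_neg_eq_self fun x => (Ioi 0).indicator F x, lintegral_indicator measurableSet_Ioi,
    two_mul]

lemma ofReal_abs_rpow {p : ℝ} (hp : 0 ≤ p) (a : ℝ) : ENNReal.ofReal (|a| ^ p) = ‖a‖ₑ ^ p := by
  rw [← ENNReal.ofReal_rpow_of_nonneg (abs_nonneg _) hp, ← Real.norm_eq_abs, ofReal_norm]

lemma gagliardo_congr {T p θ : ℝ} {v w : ℝ → ℝ} (h : v =ᵐ[vol T] w) :
    gagliardo T p θ v = gagliardo T p θ w := by
  unfold gagliardo
  refine lintegral_congr_ae ?_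
  filter_upwards [h] with s hs
  refine lintegral_congr_ae ?_
  filter_upwards [h] with t ht
  rw [hs, ht]

lemma gagliardo_J_le_of_measurable {T p θ γ : ℝ} (hT : 0 < T) (hp : 1 ≤ p) (hθγ : θ < γ)
    (hγ0 : 0 < γ) (hγ1 : γ < 1) {g : ℝ → ℝ} (hgm : Measurable g) (hg : Integrable g (vol T)) :
    gagliardo T p θ (J γ g) ≤ (ENNReal.ofReal (2 / Real.Gamma (γ + 1) * (T ^ (γ - θ) *
      (1 + 2 / (γ - θ)))) * lpENorm T p g) ^ p := by
  have hp0 : 0 < p := by linarith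
  set c := 2 / Real.Gamma (γ + 1) with hc
  have hc0 : 0 < c := div_pos two_pos (Real.Gamma_pos_of_pos (by linarith))
  set η := γ - θ with hη
  have hη0 : 0 < η := sub_pos.2 hθγ
  set D : ℝ → ℝ → ℝ≥0∞ := fun h x => ‖fullKer γ (x + h) - fullKer γ x‖ₑ with hD
  set Φ : ℝ → ℝ → ℝ≥0∞ := fun s h => ∫⁻ r, D h (s - r) * ‖zext T g r‖ₑ with hΦ
  set N : ℝ → ℝ≥0∞ := fun h => (Iio T).indicator (fun y => ENNReal.ofReal (y ^ (-(1 + θ * p)))) |h|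
    with hN
  have hzm : Measurable (zext T g) := hgm.indicator measurableSet_Ioo
  have hKm := measurable_fullKer γ
  have hNm : Measurable N := by
    have : Measurable ((Iio T).indicator (fun y : ℝ => ENNReal.ofReal (y ^ (-(1 + θ * p))))) :=
      Measurable.indicator (by fun_prop) measurableSet_Iio
    exact this.comp measurable_abs
  have hΦm : Measurable (Function.uncurry Φ) := by
    refine Measurable.lintegral_prod_right' (f := fun z : (ℝ × ℝ) × ℝ =>
      ‖fullKer γ (z.1.1 - z.2 + z.1.2) - fullKer γ (z.1.1 - z.2)‖ₑ * ‖zext T g z.2‖ₑ) ?_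
    fun_prop
  have hJ : ∀ᵐ t ∂(vol T), t ∈ Ioo 0 T ∧ Integrable (fun s => fullKer γ (t - s) * zext T g s) := by
    filter_upwards [ae_vol_mem T, ae_integrable_J hγ0 hg] with t ht h1
    refine ⟨ht, ?_⟩
    simp_rw [fullKer_mul_zext ht.2.le, ker_mul_zext ht.2.le]
    rw [integrable_indicator_iff measurableSet_Ioo]
    exact h1.const_mul _
  calc gagliardo T p θ (J γ g)
      ≤ ∫⁻ s in Ioo 0 T, ∫⁻ t in Ioo 0 T, N (t - s) * Φ s (t - s) ^ p := by
        refine lintegral_mono_ae ?_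
        filter_upwards [hJ] with s ⟨hs, hsi⟩
        refine lintegral_mono_ae ?_
        filter_upwards [hJ] with t ⟨ht, hti⟩
        rw [div_eq_mul_inv, ← Real.rpow_neg (abs_nonneg _),
          ENNReal.ofReal_mul (by positivity), ofReal_abs_rpow hp0.le, mul_comm]
        have habs : |t - s| ∈ Iio T := by
          rw [mem_Iio, abs_lt]; constructor <;> linarith [hs.1, hs.2, ht.1, ht.2]
        have e1 : N (t - s) = ENNReal.ofReal (|t - s| ^ (-(1 + θ * p))) := indicator_of_mem habs _
        rw [e1]
        gcongr
        have e2 : J γ g t - J γ g s =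
            ∫ r, (fullKer γ (s - r + (t - s)) - fullKer γ (s - r)) * zext T g r := by
          rw [J_eq_integral ht.2.le, J_eq_integral hs.2.le]
          simp_rw [← fullKer_mul_zext ht.2.le, ← fullKer_mul_zext hs.2.le]
          rw [← integral_sub hti hsi]
          refine integral_congr_ae (Eventually.of_forall fun r => ?_)
          simp only
          rw [show s - r + (t - s) = t - r by ring]
          ring
        rw [e2]
        refine (enorm_integral_le_lintegral_enorm _).trans_eq ?_
        simp only [enorm_mul, hΦ, hD]
    _ ≤ ∫⁻ s, ∫⁻ t, N (t - s) * Φ s (t - s) ^ p :=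
        (setLIntegral_le_lintegral _ _).trans
          (lintegral_mono fun s => setLIntegral_le_lintegral _ _)
    _ = ∫⁻ s, ∫⁻ h, N h * Φ s h ^ p := by
        refine lintegral_congr fun s => ?_
        exact lintegral_sub_right_eq_self (fun h => N h * Φ s h ^ p) s
    _ = ∫⁻ h, ∫⁻ s, N h * Φ s h ^ p := by
        refine lintegral_lintegral_swap (Measurable.aemeasurable ?_)
        exact (hNm.comp measurable_snd).mul (hΦm.pow_const p)
    _ ≤ ∫⁻ h, (ENNReal.ofReal c ^ p * lpENorm T p g ^ p) * (Iio T).indicator (fun y =>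
          ENNReal.ofReal (y ^ (η * p - 1))) |h| := by
        refine lintegral_mono_ae ?_
        filter_upwards [compl_mem_ae_iff.2 (measure_singleton (0 : ℝ))] with h hh0
        have hh : 0 < |h| := abs_pos.2 hh0
        rw [lintegral_const_mul _ ((hΦm.of_uncurry_right).pow_const p)]
        have hY : ∫⁻ s, Φ s h ^ p ≤ ENNReal.ofReal (c * |h| ^ γ) ^ p * lpENorm T p g ^ p := by
          refine (lintegral_convolution_rpow_le hp (k := D h) (f := fun r => ‖zext T g r‖ₑ)
            (by fun_prop) (by fun_prop)).trans ?_
          rw [lintegral_zext_rpow hp]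
          gcongr
          exact lintegral_fullKer_add_sub_le hγ0 hγ1 h
        refine (mul_le_mul_right hY _).trans (le_of_eq ?_)
        simp only [hN]
        by_cases hhT : |h| ∈ Iio T
        · rw [indicator_of_mem hhT, indicator_of_mem hhT, ENNReal.ofReal_mul hc0.le,
            ENNReal.mul_rpow_of_nonneg _ _ hp0.le,
            ENNReal.ofReal_rpow_of_nonneg (x := |h| ^ γ) (by positivity) hp0.le,
            ← Real.rpow_mul hh.le]
          have : ENNReal.ofReal (|h| ^ (η * p - 1)) =
              ENNReal.ofReal (|h| ^ (-(1 + θ * p))) * ENNReal.ofReal (|h| ^ (γ * p)) := by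
            rw [← ENNReal.ofReal_mul (by positivity), ← Real.rpow_add hh]
            congr 2
            rw [hη]; ring
          rw [this]
          ring
        · rw [indicator_of_notMem hhT, indicator_of_notMem hhT]; simp
    _ = (ENNReal.ofReal c ^ p * lpENorm T p g ^ p) *
          (2 * ENNReal.ofReal (T ^ (η * p) / (η * p))) := by
        have hm : Measurable ((Iio T).indicator (fun y : ℝ => ENNReal.ofReal (y ^ (η * p - 1)))) :=
          Measurable.indicator (by fun_prop) measurableSet_Iio
        have hm' : Measurable fun h : ℝ =>
            (Iio T).indicator (fun y : ℝ => ENNReal.ofReal (y ^ (η * p - 1))) |h| :=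
          hm.comp measurable_abs
        rw [lintegral_const_mul _ hm', lintegral_comp_abs hm,
          setLIntegral_indicator measurableSet_Iio, inter_comm, Ioi_inter_Iio,
          setLIntegral_rpow_Ioo hT.le (by have : 0 < η * p := by positivity
                                          linarith), sub_add_cancel]
    _ ≤ _ := by
        rw [ENNReal.mul_rpow_of_nonneg _ _ hp0.le, ENNReal.ofReal_mul hc0.le,
          ENNReal.mul_rpow_of_nonneg _ _ hp0.le, mul_right_comm]
        gcongr
        rw [ENNReal.ofReal_rpow_of_nonneg (by positivity) hp0.le,
          show (2 : ℝ≥0∞) = ENNReal.ofReal 2 by simp, ← ENNReal.ofReal_mul (by norm_num)]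
        apply ENNReal.ofReal_le_ofReal
        rw [Real.mul_rpow (by positivity) (by positivity), ← Real.rpow_mul hT.le,
          show 2 * (T ^ (η * p) / (η * p)) = T ^ (η * p) * (2 / (η * p)) by ring]
        gcongr
        calc 2 / (η * p) ≤ 2 / η := by
              apply div_le_div_of_nonneg_left (by norm_num) hη0
              nlinarith
          _ ≤ 1 + 2 / η := by linarith
          _ = (1 + 2 / η) ^ (1 : ℝ) := (Real.rpow_one _).symm
          _ ≤ (1 + 2 / η) ^ p := Real.rpow_le_rpow_of_exponent_le
              (by have : 0 < 2 / η := by positivity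
                  linarith) hp

/-- For `θ < γ < 1` the seminorm of order `θ` of `J^γ g` is controlled by the norm of `g`,
uniformly in `p`. -/
lemma gagliardo_J_le {T p θ γ : ℝ} (hT : 0 < T) (hp : 1 ≤ p) (hθγ : θ < γ)
    (hγ0 : 0 < γ) (hγ1 : γ < 1) {g : ℝ → ℝ} (hg : Integrable g (vol T)) :
    gagliardo T p θ (J γ g) ≤ (ENNReal.ofReal (2 / Real.Gamma (γ + 1) * (T ^ (γ - θ) *
      (1 + 2 / (γ - θ)))) * lpENorm T p g) ^ p := by
  have hae := hg.aestronglyMeasurable.ae_eq_mk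
  rw [gagliardo_congr (J_congr_ae hae), lpENorm_congr hae]
  exact gagliardo_J_le_of_measurable hT hp hθγ hγ0 hγ1
    hg.aestronglyMeasurable.stronglyMeasurable_mk.measurable (hg.congr hae)

/-! ### The norm of a fractional integral -/

lemma sobolevNorm_J_le {T p α : ℝ} (hT : 0 < T) (hp : 1 ≤ p) {k : ℕ} (hk : k < α) {v : ℝ → ℝ}
    (hv : v ∈ LpSpace T p) :
    sobolevNorm T p k (J α v) ≤
      ENNReal.ofReal (∑ j ∈ Finset.range (k + 1), T ^ (α - j) / Real.Gamma (α - j + 1)) *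
        lpENorm T p v := by
  have hpos : ∀ j ∈ Finset.range (k + 1), 0 < α - j := by
    intro j hj
    have : (j : ℝ) ≤ k := by exact_mod_cast Nat.lt_succ_iff.1 (Finset.mem_range.1 hj)
    linarith
  rw [ENNReal.ofReal_sum_of_nonneg, Finset.sum_mul, sobolevNorm]
  · refine Finset.sum_le_sum fun j hj => ?_
    have hd := hasWeakDeriv_J_add (T := T) (hpos j hj) (integrable_of_mem hp hv) j
    rw [sub_add_cancel] at hd
    rw [lpENorm_congr hd.weakDeriv_ae]
    exact lpENorm_J_le hT.le (hpos j hj) hp hv.1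
  · intro j hj
    have := hpos j hj
    have := Real.Gamma_pos_of_pos (show 0 < α - j + 1 by linarith)
    positivity

/-- `J^α` maps `L^p` to `W^{s,p}` for `s < α`, with a bound independent of `p`. -/
lemma exists_slobodeckiNorm_J_le {T s α : ℝ} (hT : 0 < T) (hs : 0 < s) (hsα : s < α) :
    ∃ C : ℝ, 0 < C ∧ ∀ p : ℝ, 1 ≤ p → ∀ v ∈ LpSpace T p, J α v ∈ W T p s ∧
      slobodeckiNorm T p s (J α v) ≤ ENNReal.ofReal C * lpENorm T p v := by
  set k := ⌊s⌋₊ with hk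
  have hks : (k : ℝ) ≤ s := Nat.floor_le hs.le
  have hsk : s < k + 1 := Nat.lt_floor_add_one s
  have hkα : (k : ℝ) < α := hks.trans_lt hsα
  set θ := s - k with hθ
  -- an order strictly between `θ` and `min 1 (α - k)`
  obtain ⟨γ, hγ1, hγ2⟩ := exists_between (show θ < min 1 (α - k) by
    rw [lt_min_iff]; constructor <;> linarith)
  have hγ0 : 0 < γ := by linarith
  have hγlt := lt_min_iff.1 hγ2
  have hβ : 0 < α - k - γ := by linarith [hγlt.2]
  set C₁ := ∑ j ∈ Finset.range (k + 1), T ^ (α - j) / Real.Gamma (α - j + 1) with hC₁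
  set C₂ := (2 / Real.Gamma (γ + 1) * (T ^ (γ - θ) * (1 + 2 / (γ - θ)))) *
    (T ^ (α - k - γ) / Real.Gamma (α - k - γ + 1)) with hC₂
  have hC₁0 : 0 ≤ C₁ := by
    refine Finset.sum_nonneg fun j hj => ?_
    have : (j : ℝ) ≤ k := by exact_mod_cast Nat.lt_succ_iff.1 (Finset.mem_range.1 hj)
    have := Real.Gamma_pos_of_pos (show 0 < α - j + 1 by linarith)
    positivity
  have hC₂0 : 0 < C₂ := by
    have := Real.Gamma_pos_of_pos (show 0 < γ + 1 by linarith)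
    have := Real.Gamma_pos_of_pos (show 0 < α - k - γ + 1 by linarith)
    have : 0 < γ - θ := by linarith
    positivity
  refine ⟨C₁ + C₂, by linarith, fun p hp v hv => ?_⟩
  have hp0 : 0 < p := by linarith
  have hvi := integrable_of_mem hp hv
  have hd : ∀ j ≤ k, HasWeakDeriv T j (J α v) (J (α - j) v) ∧ J (α - j) v ∈ LpSpace T p := by
    intro j hj
    have hj' : (j : ℝ) ≤ k := by exact_mod_cast hj
    have := hasWeakDeriv_J_add (T := T) (show 0 < α - j by linarith) hvi j
    rw [sub_add_cancel] at this
    exact ⟨this, J_mem hT.le (by linarith) hp hv⟩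
  have hS := sobolevNorm_J_le hT hp hkα hv
  have hG : gagliardo T p θ (weakDeriv T k (J α v)) ≤
      (ENNReal.ofReal C₂ * lpENorm T p v) ^ p := by
    have h1 : weakDeriv T k (J α v) =ᵐ[vol T] J γ (J (α - k - γ) v) := by
      refine (hd k le_rfl).1.weakDeriv_ae.trans ?_
      have := J_J_ae hγ0 hβ hvi
      rw [add_sub_cancel] at this
      exact this.symm
    rw [gagliardo_congr h1]
    refine (gagliardo_J_le hT hp hγ1 hγ0 hγlt.1 (integrable_J hβ hvi)).trans ?_
    have hA : 0 ≤ 2 / Real.Gamma (γ + 1) * (T ^ (γ - θ) * (1 + 2 / (γ - θ))) := by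
      have := Real.Gamma_pos_of_pos (show 0 < γ + 1 by linarith)
      have : 0 < γ - θ := by linarith
      positivity
    refine ENNReal.rpow_le_rpow ?_ hp0.le
    rw [hC₂, ENNReal.ofReal_mul (p := 2 / Real.Gamma (γ + 1) * _) hA, mul_assoc]
    exact mul_le_mul_right (lpENorm_J_le hT.le hβ hp hv.1) _
  have hmain : slobodeckiNorm T p s (J α v) ≤ ENNReal.ofReal (C₁ + C₂) * lpENorm T p v := by
    rw [ENNReal.ofReal_add hC₁0 hC₂0.le, add_mul, slobodeckiNorm]
    split_ifs with h
    · exact hS.trans le_self_add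
    · refine le_trans ?_ (ENNReal.rpow_add_rpow_le_add _ _ hp)
      gcongr
  refine ⟨⟨J_mem hT.le (hs.trans hsα) hp hv, fun j hj => ⟨_, (hd j hj).1, (hd j hj).2⟩, ?_⟩, hmain⟩
  exact hmain.trans_lt (ENNReal.mul_lt_top ENNReal.ofReal_lt_top hv.2)


/-! ### Approximation by smooth functions that vanish near the origin -/

lemma weakDeriv_congr {T : ℝ} {k : ℕ} {u v : ℝ → ℝ} (h : u =ᵐ[vol T] v) :
    weakDeriv T k u = weakDeriv T k v := by
  have : HasWeakDeriv T k u = HasWeakDeriv T k v := by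
    ext g
    exact ⟨fun h' => h'.congr h (ae_eq_refl _), fun h' => h'.congr h.symm (ae_eq_refl _)⟩
  unfold weakDeriv
  rw [this]

lemma slobodeckiNorm_congr {T p s : ℝ} {u v : ℝ → ℝ} (h : u =ᵐ[vol T] v) :
    slobodeckiNorm T p s u = slobodeckiNorm T p s v := by
  simp only [slobodeckiNorm, sobolevNorm, weakDeriv_congr h]

lemma W_congr {T p s : ℝ} {u v : ℝ → ℝ} (h : u =ᵐ[vol T] v) (hu : u ∈ W T p s) : v ∈ W T p s := by
  refine ⟨(memLp_congr_ae h).1 hu.1, fun j hj => ?_, by rw [← slobodeckiNorm_congr h]; exact hu.2.2⟩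
  obtain ⟨g, hg, hg'⟩ := hu.2.1 j hj
  exact ⟨g, hg.congr h (ae_eq_refl _), hg'⟩

/-- Smooth functions that vanish near `0` are dense in `L^p(0,T)`. -/
lemma exists_contDiff_lpENorm_sub_le {T p : ℝ} (hp : 1 ≤ p) {w : ℝ → ℝ} (hw : w ∈ LpSpace T p)
    {δ : ℝ} (hδ : 0 < δ) :
    ∃ φ : ℝ → ℝ, HasCompactSupport φ ∧ ContDiff ℝ (⊤ : ℕ∞) φ ∧ (∃ a, 0 < a ∧ ∀ x ≤ a, φ x = 0) ∧
      φ ∈ LpSpace T p ∧ lpENorm T p (w - φ) ≤ ENNReal.ofReal δ := by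
  have hp0 : 0 < p := by linarith
  have hδ2 : 0 < δ / 2 := half_pos hδ
  obtain ⟨g, hgc, hgs, hg⟩ := MemLp.exist_eLpNorm_sub_le (μ := vol T) ENNReal.ofReal_ne_top
    (one_le_ofReal hp) hw hδ2
  obtain ⟨B', hB'⟩ := hgc.exists_bound_of_continuous hgs.continuous
  set B := max B' 1 with hB
  have hB0 : 0 < B := lt_of_lt_of_le one_pos (le_max_right _ _)
  -- the cutoff changes `g` on `(0, 2 a)` only, an interval of small measure
  set a := (δ / 2 / B) ^ p / 2 with ha
  have ha0 : 0 < a := by positivity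
  set χ : ℝ → ℝ := fun x => Real.smoothTransition (x / a - 1) with hχ
  have hχs : ContDiff ℝ (⊤ : ℕ∞) χ := by
    refine Real.smoothTransition.contDiff.comp ?_
    fun_prop
  have hφs : ContDiff ℝ (⊤ : ℕ∞) (fun x => χ x * g x) := hχs.mul hgs
  have hφc : HasCompactSupport (fun x => χ x * g x) := hgc.mul_left
  have hmem : ∀ f : ℝ → ℝ, Continuous f → HasCompactSupport f →
      MemLp f (ENNReal.ofReal p) (vol T) := fun f h1 h2 =>
    (h1.memLp_of_hasCompactSupport h2 (μ := volume)).restrict _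
  refine ⟨fun x => χ x * g x, hφc, hφs, ⟨a, ha0, fun x hx => ?_⟩,
    hmem _ hφs.continuous hφc, ?_⟩
  · have : x / a - 1 ≤ 0 := by
      have := (div_le_one ha0).2 hx
      linarith
    simp [hχ, Real.smoothTransition.zero_of_nonpos this]
  · have h2 : lpENorm T p (g - fun x => χ x * g x) ≤ ENNReal.ofReal (δ / 2) := by
      have hle : ∀ᵐ x ∂(vol T), ‖(g - fun x => χ x * g x) x‖ ≤
          ‖(Ioo 0 (2 * a)).indicator (fun _ => B) x‖ := by
        filter_upwards [ae_vol_mem T] with x hx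
        by_cases hxa : x < 2 * a
        · rw [indicator_of_mem (show x ∈ Ioo 0 (2 * a) from ⟨hx.1, hxa⟩)]
          have h1 : |g x| ≤ B := (hB' x).trans (le_max_left _ _)
          have h3 : |1 - χ x| ≤ 1 := by
            rw [abs_le]
            have := Real.smoothTransition.nonneg (x / a - 1)
            have := Real.smoothTransition.le_one (x / a - 1)
            constructor <;> simp only [hχ] <;> linarith
          have h4 : (g - fun x => χ x * g x) x = (1 - χ x) * g x := by
            simp only [Pi.sub_apply]; ring
          rw [h4, Real.norm_eq_abs, abs_mul, Real.norm_of_nonneg hB0.le]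
          calc |1 - χ x| * |g x| ≤ 1 * B := by gcongr
            _ = B := one_mul _
        · have h1 : 1 ≤ x / a - 1 := by
            have := (le_div_iff₀ ha0).2 (not_lt.1 hxa)
            linarith
          simp [hχ, Real.smoothTransition.one_of_one_le h1]
      refine (eLpNorm_mono_ae hle).trans ?_
      rw [eLpNorm_indicator_const measurableSet_Ioo (by simpa using hp0) ENNReal.ofReal_ne_top,
        ENNReal.toReal_ofReal hp0.le, Real.enorm_of_nonneg hB0.le]
      have hvol : vol T (Ioo 0 (2 * a)) ≤ ENNReal.ofReal (2 * a) := by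
        refine (Measure.restrict_apply_le _ _).trans ?_
        simp
      calc ENNReal.ofReal B * vol T (Ioo 0 (2 * a)) ^ (1 / p)
          ≤ ENNReal.ofReal B * ENNReal.ofReal (2 * a) ^ (1 / p) := by gcongr
        _ = ENNReal.ofReal (δ / 2) := by
            rw [ENNReal.ofReal_rpow_of_nonneg (by positivity) (by positivity),
              ← ENNReal.ofReal_mul hB0.le]
            congr 1
            rw [ha, mul_div_cancel₀ _ two_ne_zero, ← Real.rpow_mul (by positivity),
              mul_one_div_cancel hp0.ne', Real.rpow_one]
            field_simp
    have e : (w - fun x => χ x * g x) = (w - g) + (g - fun x => χ x * g x) := by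
      simp
    rw [e]
    refine (eLpNorm_add_le (hw.sub (hmem g hgs.continuous hgc)).1
      ((hmem g hgs.continuous hgc).sub (hmem _ hφs.continuous hφc)).1
      (one_le_ofReal hp)).trans ((add_le_add hg h2).trans_eq ?_)
    rw [← ENNReal.ofReal_add hδ2.le hδ2.le, add_halves]

lemma locallyIntegrable_fullKer {α : ℝ} (hα : 0 < α) : LocallyIntegrable (fullKer α) := by
  rw [locallyIntegrable_iff]
  intro K hK
  obtain ⟨R, hR⟩ := hK.isBounded.subset_closedBall 0
  have h1 : IntegrableOn (fullKer α) (Iio (R + 1)) := by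
    rw [fullKer, IntegrableOn, integrable_indicator_iff measurableSet_Ioi, IntegrableOn,
      Measure.restrict_restrict measurableSet_Ioi, Ioi_inter_Iio]
    exact (integrableOn_rpow_Ioo (by linarith)).const_mul _
  refine h1.mono_set fun x hx => ?_
  have := hR hx
  rw [Metric.mem_closedBall, Real.dist_0_eq_abs] at this
  have := le_abs_self x
  rw [mem_Iio]; linarith

lemma J_eq_fullKer_convolution {α a : ℝ} {φ : ℝ → ℝ} (ha : 0 < a) (hφ : ∀ x ≤ a, φ x = 0) :
    J α φ = convolution (fullKer α) φ (ContinuousLinearMap.mul ℝ ℝ) volume := by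
  ext t
  rw [convolution_mul_swap, J, ← integral_const_mul, ← integral_indicator measurableSet_Ioo]
  refine integral_congr_ae (Eventually.of_forall fun s => ?_)
  simp only
  by_cases hs : s ∈ Ioo 0 t
  · rw [indicator_of_mem hs, fullKer, indicator_of_mem (show t - s ∈ Ioi 0 from sub_pos.2 hs.2),
      mul_assoc]
  · rw [indicator_of_notMem hs]
    by_cases h0 : 0 < s
    · rw [fullKer, indicator_of_notMem, zero_mul]
      exact fun h => hs ⟨h0, sub_pos.1 h⟩
    · rw [hφ s (by linarith), mul_zero]

lemma J_mem_zeroC {T α a : ℝ} (hT : 0 < T) (hα : 0 < α) {φ : ℝ → ℝ} (hφc : HasCompactSupport φ)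
    (hφs : ContDiff ℝ (⊤ : ℕ∞) φ) (ha : 0 < a) (hφ : ∀ x ≤ a, φ x = 0) (M : ℕ) :
    J α φ ∈ zeroC T M := by
  have hs : ContDiff ℝ (⊤ : ℕ∞) (J α φ) := by
    rw [J_eq_fullKer_convolution ha hφ]
    exact hφc.contDiff_convolution_right _ (locallyIntegrable_fullKer hα) hφs
  refine ⟨(hs.of_le (by exact_mod_cast le_top)).contDiffOn, fun k _ => ?_⟩
  have h0 : J α φ =ᶠ[𝓝 0] fun _ => 0 := by
    filter_upwards [Iio_mem_nhds ha] with t ht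
    rw [J, setIntegral_eq_zero_of_forall_eq_zero, mul_zero]
    intro s hs
    rw [hφ s (hs.2.trans ht).le, mul_zero]
  rw [iteratedDerivWithin_eq_iteratedDeriv (uniqueDiffOn_Icc hT)
    (hs.of_le (by exact_mod_cast le_top)).contDiffAt (left_mem_Icc.2 hT.le), h0.iteratedDeriv_eq]
  simp

/-- The inclusion `W_{α,p} ⊆ ₀W^{s,p}` for `s < α`. -/
lemma fracW_subset_zeroW {T p s α : ℝ} (hT : 0 < T) (hp : 1 ≤ p) (hs : 0 < s) (hsα : s < α) :
    fracW T p α ⊆ zeroW T p s := by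
  rintro u ⟨w, hw, huw⟩
  obtain ⟨C, hC, hest⟩ := exists_slobodeckiNorm_J_le hT hs hsα
  have hα : 0 < α := hs.trans hsα
  refine ⟨W_congr huw.symm (hest p hp w hw).1, fun δ hδ => ?_⟩
  obtain ⟨η, hη0, hηδ⟩ : ∃ η : ℝ, 0 < η ∧ ENNReal.ofReal η < δ := by
    obtain ⟨η, h1, h2⟩ := ENNReal.lt_iff_exists_nnreal_btwn.1 hδ
    exact ⟨η, by exact_mod_cast h1, by simpa using h2⟩
  obtain ⟨φ, hφc, hφs, ⟨a, ha, hφ0⟩, hφ, hle⟩ :=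
    exists_contDiff_lpENorm_sub_le hp hw (div_pos hη0 hC)
  refine ⟨J α φ, J_mem_zeroC hT hα hφc hφs ha hφ0 _, (hest p hp φ hφ).1, ?_⟩
  have e : u - J α φ =ᵐ[vol T] J α (w - φ) := by
    filter_upwards [huw, J_sub_ae hα (integrable_of_mem hp hw) (integrable_of_mem hp hφ)]
      with t h1 h2
    rw [h2, Pi.sub_apply, Pi.sub_apply, h1]
  rw [slobodeckiNorm_congr e]
  refine ((hest p hp (w - φ) (MemLp.sub hw hφ)).2.trans ?_).trans_lt hηδ
  calc ENNReal.ofReal C * lpENorm T p (w - φ)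
      ≤ ENNReal.ofReal C * ENNReal.ofReal (η / C) := by gcongr
    _ = ENNReal.ofReal η := by
        rw [← ENNReal.ofReal_mul hC.le, mul_div_cancel₀ _ hC.ne']


/-! ### Singular integrals of differences -/

/-- The inner integral of the double integral `gagliardo`. -/
def gagliardoInner (T p θ : ℝ) (w : ℝ → ℝ) (t : ℝ) : ℝ≥0∞ :=
  ∫⁻ s in Ioo 0 T, ENNReal.ofReal (|w t - w s| ^ p / |t - s| ^ (1 + θ * p))

lemma lintegral_gagliardoInner (T p θ : ℝ) (w : ℝ → ℝ) :
    ∫⁻ t in Ioo 0 T, gagliardoInner T p θ w t = gagliardo T p θ w := by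
  unfold gagliardoInner gagliardo
  refine lintegral_congr fun t => lintegral_congr fun s => ?_
  rw [abs_sub_comm (w t), abs_sub_comm t]

lemma gagliardo_mono {T p θ θ' : ℝ} (hp : 1 ≤ p) (h : θ' ≤ θ) (w : ℝ → ℝ) :
    gagliardo T p θ' w ≤ ENNReal.ofReal (T ^ ((θ - θ') * p)) * gagliardo T p θ w := by
  unfold gagliardo
  rw [← lintegral_const_mul' _ _ ENNReal.ofReal_ne_top]
  refine setLIntegral_mono' measurableSet_Ioo fun s hs => ?_
  rw [← lintegral_const_mul' _ _ ENNReal.ofReal_ne_top]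
  refine setLIntegral_mono' measurableSet_Ioo fun t ht => ?_
  have hT : 0 ≤ T := (hs.1.trans hs.2).le
  rw [← ENNReal.ofReal_mul (by positivity)]
  apply ENNReal.ofReal_le_ofReal
  rcases eq_or_ne t s with rfl | hts
  · simp [Real.zero_rpow (show p ≠ 0 by linarith)]
  have h0 : 0 < |t - s| := abs_pos.2 (sub_ne_zero.2 hts)
  have h1 : |t - s| ≤ T := by rw [abs_le]; constructor <;> linarith [hs.1, hs.2, ht.1, ht.2]
  have h2 : |t - s| ^ (1 + θ * p) = |t - s| ^ (1 + θ' * p) * |t - s| ^ ((θ - θ') * p) := by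
    rw [← Real.rpow_add h0]; congr 1; ring
  have h3 : |t - s| ^ ((θ - θ') * p) ≤ T ^ ((θ - θ') * p) :=
    Real.rpow_le_rpow h0.le h1 (mul_nonneg (by linarith) (by linarith))
  rw [h2, ← mul_div_assoc, div_le_div_iff₀ (by positivity) (by positivity)]
  calc |w t - w s| ^ p * (|t - s| ^ (1 + θ' * p) * |t - s| ^ ((θ - θ') * p))
      ≤ |w t - w s| ^ p * (|t - s| ^ (1 + θ' * p) * T ^ ((θ - θ') * p)) := by gcongr
    _ = _ := by ring

lemma enorm_sub_rpow_eq {p θ : ℝ} (hp : 0 ≤ p) (w : ℝ → ℝ) {s t : ℝ} (hst : s < t) :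
    ‖w t - w s‖ₑ ^ p = ENNReal.ofReal ((t - s) ^ (1 + θ * p)) *
      ENNReal.ofReal (|w t - w s| ^ p / |t - s| ^ (1 + θ * p)) := by
  have h := sub_pos.2 hst
  rw [← ofReal_abs_rpow hp, ← ENNReal.ofReal_mul (by positivity), abs_of_pos h]
  congr 1
  field_simp

lemma setLIntegral_comp_sub_left (F : ℝ → ℝ≥0∞) (t : ℝ) :
    ∫⁻ s in Ioo 0 t, F (t - s) = ∫⁻ x in Ioo 0 t, F x := by
  rw [← lintegral_indicator measurableSet_Ioo, ← lintegral_indicator measurableSet_Ioo,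
    ← lintegral_sub_left_eq_self _ t]
  refine lintegral_congr fun s => ?_
  have : s ∈ Ioo 0 t ↔ t - s ∈ Ioo 0 t := by
    simp only [mem_Ioo]; constructor <;> rintro ⟨h1, h2⟩ <;> constructor <;> linarith
  by_cases hs : s ∈ Ioo 0 t
  · rw [indicator_of_mem hs, indicator_of_mem (this.1 hs), sub_sub_cancel]
  · rw [indicator_of_notMem hs, indicator_of_notMem fun h => hs (this.2 h)]

/-- The singular integral in Marchaud's formula for the derivative of order `σ` is controlled by
the seminorm of order `θ > σ`: split `(t - s)^(-σ-1)` into `(t - s)^(-θ)` and the integrable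
weight `(t - s)^(θ - σ - 1)` and apply Jensen's inequality with this weight. -/
lemma lintegral_marchaud_rpow_le {T p σ θ : ℝ} (hp : 1 ≤ p) (hσθ : σ < θ)
    {w : ℝ → ℝ} (hw : Continuous w) :
    ∫⁻ t in Ioo 0 T, (∫⁻ s in Ioo 0 t, ENNReal.ofReal ((t - s) ^ (-σ - 1)) * ‖w t - w s‖ₑ) ^ p ≤
      ENNReal.ofReal (T ^ (θ - σ) / (θ - σ)) ^ (p - 1) * ENNReal.ofReal (T ^ (θ - σ)) *
        gagliardo T p θ w := by
  set η := θ - σ with hη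
  have hη0 : 0 < η := sub_pos.2 hσθ
  rw [← lintegral_gagliardoInner, ← lintegral_const_mul' _ _ (ENNReal.mul_ne_top
    (ENNReal.rpow_ne_top_of_nonneg (by linarith) ENNReal.ofReal_ne_top) ENNReal.ofReal_ne_top)]
  refine setLIntegral_mono' measurableSet_Ioo fun t ht => ?_
  have hT : 0 < T := ht.1.trans ht.2
  have e1 : ∫⁻ s in Ioo 0 t, ENNReal.ofReal ((t - s) ^ (-σ - 1)) * ‖w t - w s‖ₑ =
      ∫⁻ s in Ioo 0 t, ENNReal.ofReal ((t - s) ^ (η - 1)) *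
        (ENNReal.ofReal ((t - s) ^ (-θ)) * ‖w t - w s‖ₑ) := by
    refine setLIntegral_congr_fun measurableSet_Ioo fun s hs => ?_
    have h : 0 < t - s := sub_pos.2 hs.2
    rw [← mul_assoc, ← ENNReal.ofReal_mul (by positivity), ← Real.rpow_add h]
    congr 3
    rw [hη]; ring
  rw [e1]
  refine (lintegral_mul_rpow_le hp (by fun_prop) (by fun_prop)).trans ?_
  rw [mul_assoc]
  have hk : ∫⁻ s in Ioo 0 t, ENNReal.ofReal ((t - s) ^ (η - 1)) ≤ ENNReal.ofReal (T ^ η / η) := by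
    rw [setLIntegral_comp_sub_left (fun x => ENNReal.ofReal (x ^ (η - 1))),
      setLIntegral_rpow_Ioo ht.1.le (by linarith), sub_add_cancel]
    apply ENNReal.ofReal_le_ofReal
    have := Real.rpow_le_rpow ht.1.le ht.2.le hη0.le
    gcongr
  have hp1 : 0 ≤ p - 1 := by linarith
  gcongr
  rw [gagliardoInner, ← lintegral_const_mul' _ _ ENNReal.ofReal_ne_top]
  refine (setLIntegral_mono' measurableSet_Ioo fun s hs => ?_).trans
    (lintegral_mono_set (Ioo_subset_Ioo_right ht.2.le))
  have h : 0 < t - s := sub_pos.2 hs.2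
  rw [ENNReal.mul_rpow_of_nonneg _ _ (by linarith), enorm_sub_rpow_eq (θ := θ) (by linarith) w hs.2,
    ENNReal.ofReal_rpow_of_nonneg (by positivity) (by linarith), ← mul_assoc, ← mul_assoc,
    ← ENNReal.ofReal_mul (by positivity), ← ENNReal.ofReal_mul (by positivity),
    ← Real.rpow_mul h.le, ← Real.rpow_add h, ← Real.rpow_add h]
  gcongr
  rw [show η - 1 + -θ * p + (1 + θ * p) = η by ring]
  exact Real.rpow_le_rpow h.le (by linarith [hs.1, ht.2]) hη0.le

/-! ### A Hardy inequality -/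

/-- The mean value of `w` over `(0, t)`. -/
def mean (w : ℝ → ℝ) (t : ℝ) : ℝ := t⁻¹ * ∫ s in (0 : ℝ)..t, w s

lemma measurable_mean {w : ℝ → ℝ} (hw : Continuous w) : Measurable (mean w) := by
  have : Continuous fun t => ∫ s in (0 : ℝ)..t, w s :=
    intervalIntegral.continuous_primitive (fun a b => hw.intervalIntegrable a b) 0
  exact measurable_inv.mul this.measurable

lemma hasDerivAt_mean {w : ℝ → ℝ} (hw : Continuous w) {t : ℝ} (ht : 0 < t) :
    HasDerivAt (mean w) ((w t - mean w t) / t) t := by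
  have h := (hasDerivAt_inv ht.ne').mul (hw.integral_hasStrictDerivAt 0 t).hasDerivAt
  refine h.congr_deriv ?_
  rw [mean]
  field_simp
  ring

lemma enorm_mean_sub_le {w : ℝ → ℝ} (hw : Continuous w) {a b : ℝ} (ha : 0 < a) (hab : a ≤ b) :
    ‖mean w b - mean w a‖ₑ ≤ ∫⁻ s in Ioo a b, ‖(w s - mean w s) / s‖ₑ := by
  have hpos : ∀ x ∈ uIcc a b, 0 < x := fun x hx => by
    rw [uIcc_of_le hab] at hx; exact ha.trans_le hx.1
  have hc : ContinuousOn (fun s => (w s - mean w s) / s) (uIcc a b) := by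
    refine ContinuousOn.div (hw.continuousOn.sub fun x hx => ?_) continuousOn_id
      fun x hx => (hpos x hx).ne'
    exact (hasDerivAt_mean hw (hpos x hx)).continuousAt.continuousWithinAt
  rw [← intervalIntegral.integral_eq_sub_of_hasDerivAt
    (fun x hx => hasDerivAt_mean hw (hpos x hx)) hc.intervalIntegrable,
    intervalIntegral.integral_of_le hab, integral_Ioc_eq_integral_Ioo]
  exact enorm_integral_le_lintegral_enorm _

lemma enorm_mean_le {w : ℝ → ℝ} (hw : Continuous w) (hw0 : w 0 = 0) {t : ℝ} (ht : 0 < t) :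
    ‖mean w t‖ₑ ≤ ∫⁻ s in Ioo 0 t, ‖(w s - mean w s) / s‖ₑ := by
  have h := (hw.integral_hasStrictDerivAt 0 0).hasDerivAt.tendsto_slope_zero_right
  simp only [zero_add, intervalIntegral.integral_same, sub_zero, smul_eq_mul, hw0] at h
  have h0 : Tendsto (mean w) (𝓝[>] 0) (𝓝 0) := h
  have h1 : Tendsto (fun a => ‖mean w t - mean w a‖ₑ) (𝓝[>] 0) (𝓝 ‖mean w t - 0‖ₑ) :=
    (tendsto_const_nhds.sub h0).enorm
  rw [sub_zero] at h1
  refine le_of_tendsto h1 ?_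
  filter_upwards [Ioo_mem_nhdsGT ht] with a ha
  exact (enorm_mean_sub_le hw ha.1 ha.2.le).trans
    (lintegral_mono_set (Ioo_subset_Ioo_left ha.1.le))

lemma enorm_mean_rpow_le {p : ℝ} (hp : 1 ≤ p) {w : ℝ → ℝ} (hw : Continuous w) {t : ℝ}
    (ht : 0 < t) :
    ‖mean w t‖ₑ ^ p ≤ ENNReal.ofReal t⁻¹ * ∫⁻ s in Ioo 0 t, ‖w s‖ₑ ^ p := by
  have hp0 : 0 < p := by linarith
  have h1 : ‖mean w t‖ₑ ≤ ∫⁻ s in Ioo 0 t, ENNReal.ofReal t⁻¹ * ‖w s‖ₑ := by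
    rw [lintegral_const_mul' _ _ ENNReal.ofReal_ne_top, mean, enorm_mul,
      Real.enorm_of_nonneg (by positivity), intervalIntegral.integral_of_le ht.le,
      integral_Ioc_eq_integral_Ioo]
    gcongr
    exact enorm_integral_le_lintegral_enorm _
  refine (ENNReal.rpow_le_rpow h1 hp0.le).trans
    ((lintegral_mul_rpow_le hp (by fun_prop) (by fun_prop)).trans (le_of_eq ?_))
  rw [lintegral_const_mul' _ _ ENNReal.ofReal_ne_top]
  have : ∫⁻ _ in Ioo 0 t, ENNReal.ofReal t⁻¹ = 1 := by
    simp only [lintegral_const, Measure.restrict_apply MeasurableSet.univ, univ_inter,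
      Real.volume_Ioo, sub_zero]
    rw [← ENNReal.ofReal_mul (by positivity), inv_mul_cancel₀ ht.ne', ENNReal.ofReal_one]
  rw [this, ENNReal.one_rpow, one_mul]

lemma enorm_sub_mean_rpow_le {T p θ : ℝ} (hp : 1 ≤ p) (hθ : 0 ≤ θ) {w : ℝ → ℝ} (hw : Continuous w)
    {t : ℝ} (ht : t ∈ Ioo 0 T) :
    ‖w t - mean w t‖ₑ ^ p ≤ ENNReal.ofReal (t ^ (θ * p)) * gagliardoInner T p θ w t := by
  have hp0 : 0 < p := by linarith
  have hθp : 0 ≤ θ * p := by positivity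
  have h1 : mean (fun s => w t - w s) t = w t - mean w t := by
    have := ht.1.ne'
    rw [mean, intervalIntegral.integral_sub (by simp) (hw.intervalIntegrable _ _), mean]
    simp only [intervalIntegral.integral_const, sub_zero, smul_eq_mul]
    field_simp
  rw [← h1]
  refine (enorm_mean_rpow_le hp (by fun_prop) ht.1).trans ?_
  rw [gagliardoInner, ← lintegral_const_mul' _ _ ENNReal.ofReal_ne_top,
    ← lintegral_const_mul' _ _ ENNReal.ofReal_ne_top]
  refine (setLIntegral_mono' measurableSet_Ioo fun s hs => ?_).trans
    (lintegral_mono_set (Ioo_subset_Ioo_right ht.2.le))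
  have h : 0 < t - s := sub_pos.2 hs.2
  have ht0 : 0 < t := ht.1
  rw [enorm_sub_rpow_eq (θ := θ) hp0.le w hs.2, ← mul_assoc, ← ENNReal.ofReal_mul (by positivity)]
  gcongr
  calc t⁻¹ * (t - s) ^ (1 + θ * p) ≤ t⁻¹ * t ^ (1 + θ * p) := by
        have := Real.rpow_le_rpow h.le (show t - s ≤ t by linarith [hs.1])
          (show 0 ≤ 1 + θ * p by linarith)
        gcongr
    _ = t ^ (θ * p) := by
        rw [Real.rpow_add ht.1, Real.rpow_one, inv_mul_cancel_left₀ ht.1.ne']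

/-- Jensen's inequality with the weight `s^(b - 1)`, `b = θ - 1 / p`, for the increments of the
mean value. -/
lemma lintegral_deriv_mean_rpow_le {T p θ : ℝ} (hp : 1 ≤ p) (hθ : 0 ≤ θ) {w : ℝ → ℝ}
    (hw : Continuous w) {S : Set ℝ} (hS : MeasurableSet S) (hST : S ⊆ Ioo 0 T) {B : ℝ≥0∞}
    (hB : B ≠ ⊤) (hSB : ∀ s ∈ S, ENNReal.ofReal (s ^ (θ - 1 / p)) ≤ B) :
    (∫⁻ s in S, ‖(w s - mean w s) / s‖ₑ) ^ p ≤
      (∫⁻ s in S, ENNReal.ofReal (s ^ (θ - 1 / p - 1))) ^ (p - 1) * (B * gagliardo T p θ w) := by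
  have hp0 : 0 < p := by linarith
  have hm := measurable_mean hw
  set b := θ - 1 / p with hb
  have e1 : ∫⁻ s in S, ‖(w s - mean w s) / s‖ₑ =
      ∫⁻ s in S, ENNReal.ofReal (s ^ (b - 1)) *
        (ENNReal.ofReal (s ^ (-b)) * ‖w s - mean w s‖ₑ) := by
    refine setLIntegral_congr_fun hS fun s hs => ?_
    have h : 0 < s := (hST hs).1
    rw [← mul_assoc, ← ENNReal.ofReal_mul (by positivity), ← Real.rpow_add h, div_eq_inv_mul,
      enorm_mul, Real.enorm_of_nonneg (by positivity), ← Real.rpow_neg_one]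
    congr 3
    ring
  rw [e1]
  refine (lintegral_mul_rpow_le hp (by fun_prop) (by fun_prop)).trans ?_
  gcongr
  rw [← lintegral_gagliardoInner, ← lintegral_const_mul' _ _ hB]
  refine (setLIntegral_mono' hS fun s hs => ?_).trans (lintegral_mono_set hST)
  have h : 0 < s := (hST hs).1
  rw [ENNReal.mul_rpow_of_nonneg _ _ hp0.le,
    ENNReal.ofReal_rpow_of_nonneg (by positivity) hp0.le, ← Real.rpow_mul h.le]
  calc ENNReal.ofReal (s ^ (b - 1)) * (ENNReal.ofReal (s ^ (-b * p)) * ‖w s - mean w s‖ₑ ^ p)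
      ≤ ENNReal.ofReal (s ^ (b - 1)) * (ENNReal.ofReal (s ^ (-b * p)) *
        (ENNReal.ofReal (s ^ (θ * p)) * gagliardoInner T p θ w s)) := by
        gcongr
        exact enorm_sub_mean_rpow_le hp hθ hw (hST hs)
    _ = ENNReal.ofReal (s ^ b) * gagliardoInner T p θ w s := by
        rw [← mul_assoc, ← mul_assoc, ← ENNReal.ofReal_mul (by positivity),
          ← ENNReal.ofReal_mul (by positivity), ← Real.rpow_add h, ← Real.rpow_add h]
        congr 3
        rw [hb]
        field_simp
        ring
    _ ≤ B * gagliardoInner T p θ w s := by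
        gcongr
        exact hSB s hs

lemma setLIntegral_rpow_Ioo_le_of_neg {T t b : ℝ} (ht : 0 < t) (hb : b < 0) :
    ∫⁻ s in Ioo t T, ENNReal.ofReal (s ^ (b - 1)) ≤ ENNReal.ofReal (t ^ b / |b|) := by
  refine (lintegral_mono_set (show Ioo t T ⊆ Ioi t from fun x hx => hx.1)).trans ?_
  rw [← ofReal_integral_eq_lintegral_ofReal (integrableOn_Ioi_rpow_of_lt (by linarith) ht),
    integral_Ioi_rpow_of_lt (by linarith) ht, sub_add_cancel, abs_of_neg hb, neg_div, div_neg]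
  filter_upwards [ae_restrict_mem measurableSet_Ioi] with s hs
  exact Real.rpow_nonneg (ht.trans hs).le _

/-- Pointwise bound for the mean value.  For `θ p > 1` integrate its derivative from `0`, where it
vanishes; for `θ p < 1` integrate from `T`. -/
lemma exists_enorm_mean_rpow_le {T p θ : ℝ} (hT : 0 < T) (hp : 1 ≤ p) (hθ : 0 ≤ θ)
    (hθp : θ * p ≠ 1) :
    ∃ C : ℝ≥0∞, C ≠ ⊤ ∧ ∀ w : ℝ → ℝ, Continuous w → w 0 = 0 → ∀ t ∈ Ioo 0 T,
      ‖mean w t‖ₑ ^ p ≤ C * ENNReal.ofReal (t ^ (θ * p - 1)) *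
        (gagliardo T p θ w + lpENorm T p w ^ p) := by
  have hp0 : 0 < p := by linarith
  have hp1 : 0 ≤ p - 1 := by linarith
  set b := θ - 1 / p with hb
  have hbp : b * p = θ * p - 1 := by rw [hb]; field_simp
  have hb0 : b ≠ 0 := by
    intro h; rw [h, zero_mul] at hbp; exact hθp (by linarith)
  set K := ENNReal.ofReal (|b|⁻¹) ^ (p - 1) with hK
  have hK_top : K ≠ ⊤ := ENNReal.rpow_ne_top_of_nonneg hp1 ENNReal.ofReal_ne_top
  have hkey : ∀ t : ℝ, 0 < t → ENNReal.ofReal (t ^ b / |b|) ^ (p - 1) * ENNReal.ofReal (t ^ b) =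
      K * ENNReal.ofReal (t ^ (θ * p - 1)) := by
    intro t ht
    rw [div_eq_mul_inv, ENNReal.ofReal_mul (by positivity), ENNReal.mul_rpow_of_nonneg _ _ hp1,
      mul_comm (_ ^ (p - 1)) (_ ^ (p - 1)), mul_assoc,
      ENNReal.ofReal_rpow_of_nonneg (x := t ^ b) (by positivity) hp1, ← Real.rpow_mul ht.le,
      ← ENNReal.ofReal_mul (by positivity), ← Real.rpow_add ht]
    congr 3
    rw [← hbp]; ring
  rcases lt_or_gt_of_ne hb0 with hneg | hpos
  · refine ⟨2 ^ (p - 1) * (ENNReal.ofReal (T⁻¹ * T ^ (-(θ * p - 1))) + K), ?_, ?_⟩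
    · exact ENNReal.mul_ne_top (ENNReal.rpow_ne_top_of_nonneg hp1 (by simp))
        (ENNReal.add_ne_top.2 ⟨ENNReal.ofReal_ne_top, hK_top⟩)
    intro w hw _ t ht
    have h1 : ‖mean w t‖ₑ ≤ ‖mean w T‖ₑ + ∫⁻ s in Ioo t T, ‖(w s - mean w s) / s‖ₑ := by
      have : mean w t = mean w T - (mean w T - mean w t) := by ring
      rw [this]
      exact enorm_sub_le.trans (by gcongr; exact enorm_mean_sub_le hw ht.1 ht.2.le)
    have h2 : ‖mean w T‖ₑ ^ p ≤ ENNReal.ofReal (T⁻¹ * T ^ (-(θ * p - 1))) *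
        ENNReal.ofReal (t ^ (θ * p - 1)) * lpENorm T p w ^ p := by
      rw [lpENorm_rpow hp, ← ENNReal.ofReal_mul (by positivity)]
      refine (enorm_mean_rpow_le hp hw hT).trans ?_
      gcongr
      have h3 : T ^ (θ * p - 1) ≤ t ^ (θ * p - 1) :=
        Real.rpow_le_rpow_of_nonpos ht.1 ht.2.le (by rw [← hbp]; nlinarith)
      rw [Real.rpow_neg hT.le, mul_assoc]
      have h4 := Real.rpow_pos_of_pos hT (θ * p - 1)
      have : 1 ≤ (T ^ (θ * p - 1))⁻¹ * t ^ (θ * p - 1) := by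
        rw [inv_mul_eq_div, one_le_div h4]; exact h3
      exact le_mul_of_one_le_right (by positivity) this
    have h3 : (∫⁻ s in Ioo t T, ‖(w s - mean w s) / s‖ₑ) ^ p ≤
        K * ENNReal.ofReal (t ^ (θ * p - 1)) * gagliardo T p θ w := by
      refine (lintegral_deriv_mean_rpow_le hp hθ hw measurableSet_Ioo
        (Ioo_subset_Ioo_left ht.1.le) (B := ENNReal.ofReal (t ^ b)) ENNReal.ofReal_ne_top
        fun s hs => ENNReal.ofReal_le_ofReal
          (Real.rpow_le_rpow_of_nonpos ht.1 hs.1.le hneg.le)).trans ?_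
      rw [← hkey t ht.1, mul_assoc]
      gcongr
      exact setLIntegral_rpow_Ioo_le_of_neg ht.1 hneg
    calc ‖mean w t‖ₑ ^ p
        ≤ (‖mean w T‖ₑ + ∫⁻ s in Ioo t T, ‖(w s - mean w s) / s‖ₑ) ^ p :=
          ENNReal.rpow_le_rpow h1 hp0.le
      _ ≤ 2 ^ (p - 1) * (‖mean w T‖ₑ ^ p + (∫⁻ s in Ioo t T, ‖(w s - mean w s) / s‖ₑ) ^ p) :=
          ENNReal.rpow_add_le_mul_rpow_add_rpow _ _ hp
      _ ≤ 2 ^ (p - 1) * (ENNReal.ofReal (T⁻¹ * T ^ (-(θ * p - 1))) *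
            ENNReal.ofReal (t ^ (θ * p - 1)) * (gagliardo T p θ w + lpENorm T p w ^ p) +
            K * ENNReal.ofReal (t ^ (θ * p - 1)) * (gagliardo T p θ w + lpENorm T p w ^ p)) := by
          gcongr
          · exact h2.trans (by gcongr; exact le_add_self)
          · exact h3.trans (by gcongr; exact le_self_add)
      _ = _ := by ring
  · refine ⟨K, hK_top, fun w hw hw0 t ht => ?_⟩
    refine (ENNReal.rpow_le_rpow (enorm_mean_le hw hw0 ht.1) hp0.le).trans ?_
    refine (lintegral_deriv_mean_rpow_le hp hθ hw measurableSet_Ioo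
        (Ioo_subset_Ioo_right ht.2.le) (B := ENNReal.ofReal (t ^ b)) ENNReal.ofReal_ne_top
        fun s hs => ENNReal.ofReal_le_ofReal
          (Real.rpow_le_rpow hs.1.le hs.2.le hpos.le)).trans ?_
    rw [← hkey t ht.1, mul_assoc, setLIntegral_rpow_Ioo ht.1.le (by linarith), sub_add_cancel,
      abs_of_pos hpos]
    gcongr
    exact le_self_add

lemma exists_hardy_of_ne {T p σ θ : ℝ} (hT : 0 < T) (hp : 1 ≤ p) (hθ : 0 ≤ θ) (hσθ : σ < θ)
    (hθp : θ * p ≠ 1) :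
    ∃ C : ℝ≥0∞, C ≠ ⊤ ∧ ∀ w : ℝ → ℝ, Continuous w → w 0 = 0 →
      ∫⁻ t in Ioo 0 T, (ENNReal.ofReal (t ^ (-σ)) * ‖w t‖ₑ) ^ p ≤
        C * (gagliardo T p θ w + lpENorm T p w ^ p) := by
  have hp0 : 0 < p := by linarith
  have hp1 : 0 ≤ p - 1 := by linarith
  obtain ⟨C, hC, hmean⟩ := exists_enorm_mean_rpow_le hT hp hθ hθp
  set η := θ - σ with hη
  have hη0 : 0 < η := sub_pos.2 hσθ
  have hηp : 0 < η * p := by positivity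
  have h2top : (2 : ℝ≥0∞) ^ (p - 1) ≠ ⊤ := ENNReal.rpow_ne_top_of_nonneg hp1 (by simp)
  refine ⟨2 ^ (p - 1) * (ENNReal.ofReal (T ^ (η * p)) +
    C * ENNReal.ofReal (T ^ (η * p) / (η * p))), ?_, fun w hw hw0 => ?_⟩
  · exact ENNReal.mul_ne_top h2top (ENNReal.add_ne_top.2
      ⟨ENNReal.ofReal_ne_top, ENNReal.mul_ne_top hC ENNReal.ofReal_ne_top⟩)
  set N := gagliardo T p θ w + lpENorm T p w ^ p with hN
  calc ∫⁻ t in Ioo 0 T, (ENNReal.ofReal (t ^ (-σ)) * ‖w t‖ₑ) ^ p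
      ≤ ∫⁻ t in Ioo 0 T, 2 ^ (p - 1) * (ENNReal.ofReal (T ^ (η * p)) * gagliardoInner T p θ w t +
          C * N * ENNReal.ofReal (t ^ (η * p - 1))) := by
        refine setLIntegral_mono' measurableSet_Ioo fun t ht => ?_
        have ht0 := ht.1
        rw [ENNReal.mul_rpow_of_nonneg _ _ hp0.le,
          ENNReal.ofReal_rpow_of_nonneg (by positivity) hp0.le, ← Real.rpow_mul ht0.le]
        have h1 : ‖w t‖ₑ ^ p ≤ 2 ^ (p - 1) * (‖w t - mean w t‖ₑ ^ p + ‖mean w t‖ₑ ^ p) := by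
          refine le_trans ?_ (ENNReal.rpow_add_le_mul_rpow_add_rpow _ _ hp)
          refine ENNReal.rpow_le_rpow ?_ hp0.le
          calc ‖w t‖ₑ = ‖(w t - mean w t) + mean w t‖ₑ := by rw [sub_add_cancel]
            _ ≤ _ := enorm_add_le _ _
        calc ENNReal.ofReal (t ^ (-σ * p)) * ‖w t‖ₑ ^ p
            ≤ ENNReal.ofReal (t ^ (-σ * p)) * (2 ^ (p - 1) *
              (ENNReal.ofReal (t ^ (θ * p)) * gagliardoInner T p θ w t +
                C * ENNReal.ofReal (t ^ (θ * p - 1)) * N)) := by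
              gcongr
              refine h1.trans ?_
              gcongr
              · exact enorm_sub_mean_rpow_le hp hθ hw ht
              · exact hmean w hw hw0 t ht
          _ = 2 ^ (p - 1) * ((ENNReal.ofReal (t ^ (-σ * p)) * ENNReal.ofReal (t ^ (θ * p))) *
                gagliardoInner T p θ w t + C * N * (ENNReal.ofReal (t ^ (-σ * p)) *
                ENNReal.ofReal (t ^ (θ * p - 1)))) := by ring
          _ ≤ _ := by
              rw [← ENNReal.ofReal_mul (by positivity), ← ENNReal.ofReal_mul (by positivity),
                ← Real.rpow_add ht0, ← Real.rpow_add ht0,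
                show -σ * p + θ * p = η * p by rw [hη]; ring,
                show -σ * p + (θ * p - 1) = η * p - 1 by rw [hη]; ring]
              have := ht.2
              gcongr
    _ = 2 ^ (p - 1) * (ENNReal.ofReal (T ^ (η * p)) * gagliardo T p θ w +
          C * N * ENNReal.ofReal (T ^ (η * p) / (η * p))) := by
        rw [lintegral_const_mul' _ _ h2top, lintegral_add_right _ (by fun_prop),
          lintegral_const_mul' _ _ ENNReal.ofReal_ne_top, lintegral_gagliardoInner,
          lintegral_const_mul _ (by fun_prop), setLIntegral_rpow_Ioo hT.le (by linarith),
          sub_add_cancel]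
    _ ≤ 2 ^ (p - 1) * (ENNReal.ofReal (T ^ (η * p)) * N +
          C * N * ENNReal.ofReal (T ^ (η * p) / (η * p))) := by
        gcongr
        exact le_self_add
    _ = _ := by ring

/-- A fractional Hardy inequality for functions that vanish at `0`.  There is no restriction on
`θ p`, since `σ < θ` leaves room to avoid the critical value `θ p = 1`. -/
lemma exists_hardy {T p σ θ : ℝ} (hT : 0 < T) (hp : 1 ≤ p) (hσ : 0 ≤ σ) (hσθ : σ < θ) :
    ∃ C : ℝ≥0∞, C ≠ ⊤ ∧ ∀ w : ℝ → ℝ, Continuous w → w 0 = 0 →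
      ∫⁻ t in Ioo 0 T, (ENNReal.ofReal (t ^ (-σ)) * ‖w t‖ₑ) ^ p ≤
        C * (gagliardo T p θ w + lpENorm T p w ^ p) := by
  obtain ⟨θ', h1, h2, h3⟩ : ∃ θ', σ < θ' ∧ θ' ≤ θ ∧ θ' * p ≠ 1 := by
    by_cases h : θ * p = 1
    · refine ⟨(σ + θ) / 2, by linarith, by linarith, fun h' => ?_⟩
      have : ((σ + θ) / 2 - θ) * p = 0 := by linarith
      rcases mul_eq_zero.1 this with h | h <;> linarith
    · exact ⟨θ, hσθ, le_rfl, h⟩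
  obtain ⟨C, hC, hle⟩ := exists_hardy_of_ne hT hp (hσ.trans h1.le) h1 h3
  refine ⟨C * (ENNReal.ofReal (T ^ ((θ - θ') * p)) + 1), ENNReal.mul_ne_top hC
    (ENNReal.add_ne_top.2 ⟨ENNReal.ofReal_ne_top, by simp⟩), fun w hw hw0 => ?_⟩
  refine (hle w hw hw0).trans ?_
  rw [mul_assoc, add_mul, one_mul]
  gcongr C * ?_
  calc gagliardo T p θ' w + lpENorm T p w ^ p
      ≤ ENNReal.ofReal (T ^ ((θ - θ') * p)) * gagliardo T p θ w + lpENorm T p w ^ p := by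
        gcongr
        exact gagliardo_mono hp h2 w
    _ ≤ _ := by
        gcongr
        · exact le_self_add
        · exact le_add_self


/-! ### Marchaud's formula -/

lemma hasDerivAt_of_contDiffOn {T : ℝ} {w : ℝ → ℝ} (hw : ContDiffOn ℝ 1 w (Icc 0 T)) {s : ℝ}
    (hs : s ∈ Ioo 0 T) : HasDerivAt w (derivWithin w (Icc 0 T) s) s :=
  ((hw.differentiableOn (by simp)) s (Ioo_subset_Icc_self hs)).hasDerivWithinAt.hasDerivAt
    (Icc_mem_nhds hs.1 hs.2)

lemma exists_lipschitz_bound {T : ℝ} (hT : 0 < T) {w : ℝ → ℝ} (hw : ContDiffOn ℝ 1 w (Icc 0 T)) :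
    ∃ L : ℝ, 0 ≤ L ∧ (∀ s ∈ Icc 0 T, |derivWithin w (Icc 0 T) s| ≤ L) ∧
      ∀ s ∈ Icc 0 T, ∀ t ∈ Icc 0 T, |w t - w s| ≤ L * |t - s| := by
  obtain ⟨L, hL⟩ := isCompact_Icc.exists_bound_of_continuousOn
    (hw.continuousOn_derivWithin (uniqueDiffOn_Icc hT) le_rfl)
  refine ⟨L, (norm_nonneg _).trans (hL 0 (left_mem_Icc.2 hT.le)), hL, fun s hs t ht => ?_⟩
  exact (convex_Icc 0 T).norm_image_sub_le_of_norm_derivWithin_le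
    (hw.differentiableOn (by simp)) hL hs ht

/-- Marchaud's formula for the derivative of order `σ` of a `C^1` function vanishing at `0`:
integrate `(t - s)^(-σ) w'(s)` by parts, with the primitive `w(s) - w(t)` of `w'`. -/
lemma J_derivWithin_eq {T σ : ℝ} (hT : 0 < T) (hσ1 : σ < 1) {w : ℝ → ℝ}
    (hw : ContDiffOn ℝ 1 w (Icc 0 T)) (hw0 : w 0 = 0) {t : ℝ} (ht : t ∈ Ioo 0 T) :
    J (1 - σ) (derivWithin w (Icc 0 T)) t = (Real.Gamma (1 - σ))⁻¹ *
      (t ^ (-σ) * w t + σ * ∫ s in Ioo 0 t, (t - s) ^ (-σ - 1) * (w t - w s)) := by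
  obtain ⟨L, hL0, hL1, hL2⟩ := exists_lipschitz_bound hT hw
  set w' := derivWithin w (Icc 0 T) with hw'
  have hsub : Ioo 0 t ⊆ Icc 0 T := fun s hs => ⟨hs.1.le, hs.2.le.trans ht.2.le⟩
  have htI : t ∈ Icc 0 T := Ioo_subset_Icc_self ht
  have hwc : ContinuousOn w (Ioo 0 t) := hw.continuousOn.mono hsub
  have hw'c : ContinuousOn w' (Ioo 0 t) :=
    (hw.continuousOn_derivWithin (uniqueDiffOn_Icc hT) le_rfl).mono hsub
  have hpc : ∀ r : ℝ, ContinuousOn (fun s : ℝ => (t - s) ^ r) (Ioo 0 t) := fun r =>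
    (continuousOn_const.sub continuousOn_id).rpow_const fun s hs =>
      Or.inl (sub_pos.2 hs.2).ne'
  have hdom : IntegrableOn (fun s => (t - s) ^ (-σ) * L) (Ioo 0 t) := by
    have h := ((intervalIntegral.intervalIntegrable_rpow' (a := t) (b := 0) (r := -σ)
      (by linarith)).comp_sub_left t)
    simp only [sub_self, sub_zero] at h
    exact ((intervalIntegrable_iff_integrableOn_Ioo_of_le ht.1.le).1 h).mul_const L
  have hi1 : IntegrableOn (fun s => (t - s) ^ (-σ - 1) * (w t - w s)) (Ioo 0 t) := by
    refine Integrable.mono' hdom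
      (((hpc _).mul (continuousOn_const.sub hwc)).aestronglyMeasurable measurableSet_Ioo) ?_
    filter_upwards [ae_restrict_mem measurableSet_Ioo] with s hs
    have h : 0 < t - s := sub_pos.2 hs.2
    have h1 := hL2 s (hsub hs) t htI
    rw [abs_of_pos h] at h1
    rw [norm_mul, Real.norm_of_nonneg (by positivity), Real.norm_eq_abs]
    calc (t - s) ^ (-σ - 1) * |w t - w s| ≤ (t - s) ^ (-σ - 1) * (L * (t - s)) := by gcongr
      _ = (t - s) ^ (-σ - 1 + 1) * L := by rw [Real.rpow_add h, Real.rpow_one]; ring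
      _ = _ := by rw [sub_add_cancel]
  have hi2 : IntegrableOn (fun s => (t - s) ^ (-σ) * w' s) (Ioo 0 t) := by
    refine Integrable.mono' hdom (((hpc _).mul hw'c).aestronglyMeasurable measurableSet_Ioo) ?_
    filter_upwards [ae_restrict_mem measurableSet_Ioo] with s hs
    have h : 0 < t - s := sub_pos.2 hs.2
    rw [norm_mul, Real.norm_of_nonneg (by positivity)]
    have := hL1 s (hsub hs)
    gcongr
    exact this
  have hderiv : ∀ s ∈ Ioo 0 t, HasDerivAt (fun s => (t - s) ^ (-σ) * (w s - w t))
      ((t - s) ^ (-σ) * w' s - σ * ((t - s) ^ (-σ - 1) * (w t - w s))) s := by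
    intro s hs
    have h : 0 < t - s := sub_pos.2 hs.2
    have h1 : HasDerivAt (fun s => t - s) (-1) s := by
      simpa using (hasDerivAt_id s).const_sub t
    have h2 := h1.rpow_const (p := -σ) (Or.inl h.ne')
    have h3 := (hasDerivAt_of_contDiffOn hw ⟨hs.1, hs.2.trans ht.2⟩).sub_const (w t)
    refine (h2.mul h3).congr_deriv ?_
    ring
  have h0 : Tendsto (fun s => (t - s) ^ (-σ) * (w s - w t)) (𝓝[>] 0)
      (𝓝 (t ^ (-σ) * (0 - w t))) := by
    have hwt : Tendsto w (𝓝[>] 0) (𝓝 0) := by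
      have h1 := hw.continuousOn 0 (left_mem_Icc.2 hT.le)
      rw [ContinuousWithinAt, hw0] at h1
      refine h1.mono_left ?_
      rw [← nhdsWithin_Ioo_eq_nhdsGT hT]
      exact nhdsWithin_mono _ Ioo_subset_Icc_self
    refine Tendsto.mul ?_ (hwt.sub_const _)
    have : ContinuousAt (fun s : ℝ => (t - s) ^ (-σ)) 0 := by
      refine ContinuousAt.rpow_const (by fun_prop) (Or.inl ?_)
      simpa using ht.1.ne'
    have h2 := this.tendsto.mono_left (nhdsWithin_le_nhds (s := Ioi 0))
    simpa using h2
  have h1 : Tendsto (fun s => (t - s) ^ (-σ) * (w s - w t)) (𝓝[<] t) (𝓝 0) := by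
    have hz : Tendsto (fun s : ℝ => (t - s) ^ (1 - σ) * L) (𝓝[<] t) (𝓝 0) := by
      have : ContinuousAt (fun s : ℝ => (t - s) ^ (1 - σ) * L) t := by
        refine ContinuousAt.mul (ContinuousAt.rpow_const (by fun_prop) (Or.inr ?_)) (by fun_prop)
        linarith
      have h2 := this.tendsto.mono_left (nhdsWithin_le_nhds (s := Iio t))
      simpa [Real.zero_rpow (show 1 - σ ≠ 0 by linarith)] using h2
    refine squeeze_zero_norm' ?_ hz
    filter_upwards [Ioo_mem_nhdsLT ht.1] with s hs
    have h : 0 < t - s := sub_pos.2 hs.2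
    have h1 := hL2 t htI s (hsub hs)
    rw [abs_sub_comm s t, abs_of_pos h] at h1
    rw [norm_mul, Real.norm_of_nonneg (by positivity), Real.norm_eq_abs]
    calc (t - s) ^ (-σ) * |w s - w t| ≤ (t - s) ^ (-σ) * (L * (t - s)) := by gcongr
      _ = (t - s) ^ (-σ + 1) * L := by rw [Real.rpow_add h, Real.rpow_one]; ring
      _ = _ := by rw [neg_add_eq_sub]
  have hint : IntervalIntegrable (fun s => (t - s) ^ (-σ) * w' s -
      σ * ((t - s) ^ (-σ - 1) * (w t - w s))) volume 0 t :=
    (intervalIntegrable_iff_integrableOn_Ioo_of_le ht.1.le).2 (hi2.sub (hi1.const_mul σ))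
  have hFTC := intervalIntegral.integral_eq_sub_of_hasDerivAt_of_tendsto ht.1 hderiv hint h0 h1
  rw [intervalIntegral.integral_of_le ht.1.le, integral_Ioc_eq_integral_Ioo,
    integral_sub hi2 (hi1.const_mul σ), integral_const_mul] at hFTC
  rw [J, show 1 - σ - 1 = -σ by ring]
  congr 1
  linarith

/-- The derivative of order `σ` of a `C^1` function vanishing at `0` is controlled in `L^p` by its
norm of order `θ > σ`. -/
lemma exists_lpENorm_J_derivWithin_le {T p σ θ : ℝ} (hT : 0 < T) (hp : 1 ≤ p) (hσ0 : 0 < σ)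
    (hσ1 : σ < 1) (hσθ : σ < θ) :
    ∃ C : ℝ≥0∞, C ≠ ⊤ ∧ ∀ w : ℝ → ℝ, ContDiffOn ℝ 1 w (Icc 0 T) → w 0 = 0 →
      lpENorm T p (J (1 - σ) (derivWithin w (Icc 0 T))) ^ p ≤
        C * (gagliardo T p θ w + lpENorm T p w ^ p) := by
  have hp0 : 0 < p := by linarith
  have hp1 : 0 ≤ p - 1 := by linarith
  obtain ⟨C, hC, hhardy⟩ := exists_hardy hT hp hσ0.le hσθ
  set K := ENNReal.ofReal (T ^ (θ - σ) / (θ - σ)) ^ (p - 1) * ENNReal.ofReal (T ^ (θ - σ)) with hK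
  have hKtop : K ≠ ⊤ := ENNReal.mul_ne_top
    (ENNReal.rpow_ne_top_of_nonneg hp1 ENNReal.ofReal_ne_top) ENNReal.ofReal_ne_top
  set c := ENNReal.ofReal (Real.Gamma (1 - σ))⁻¹ with hc
  set d := ENNReal.ofReal σ with hd
  have hctop : c ^ p * 2 ^ (p - 1) ≠ ⊤ := ENNReal.mul_ne_top
    (ENNReal.rpow_ne_top_of_nonneg hp0.le ENNReal.ofReal_ne_top)
    (ENNReal.rpow_ne_top_of_nonneg hp1 (by simp))
  have hdtop : d ^ p ≠ ⊤ := ENNReal.rpow_ne_top_of_nonneg hp0.le ENNReal.ofReal_ne_top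
  refine ⟨c ^ p * 2 ^ (p - 1) * (C + d ^ p * K), ENNReal.mul_ne_top hctop
    (ENNReal.add_ne_top.2 ⟨hC, ENNReal.mul_ne_top hdtop hKtop⟩), fun w hw hw0 => ?_⟩
  -- a continuous function on the line that agrees with `w` on `[0, T]`
  set z : ℝ → ℝ := IccExtend hT.le ((Icc 0 T).domRestrict w) with hz
  have hzc : Continuous z := hw.continuousOn.domRestrict.Icc_extend'
  have hzw : ∀ s ∈ Icc 0 T, z s = w s := fun s hs => IccExtend_of_mem _ _ hs
  have hzae : z =ᵐ[vol T] w := by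
    filter_upwards [ae_vol_mem T] with s hs using hzw s (Ioo_subset_Icc_self hs)
  have hz0 : z 0 = 0 := by rw [hzw 0 (left_mem_Icc.2 hT.le), hw0]
  rw [← gagliardo_congr hzae, ← lpENorm_congr hzae, lpENorm_rpow hp]
  set N := gagliardo T p θ z + lpENorm T p z ^ p with hN
  calc ∫⁻ t in Ioo 0 T, ‖J (1 - σ) (derivWithin w (Icc 0 T)) t‖ₑ ^ p
      ≤ ∫⁻ t in Ioo 0 T, c ^ p * 2 ^ (p - 1) * ((ENNReal.ofReal (t ^ (-σ)) * ‖z t‖ₑ) ^ p +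
          d ^ p * (∫⁻ s in Ioo 0 t, ENNReal.ofReal ((t - s) ^ (-σ - 1)) * ‖z t - z s‖ₑ) ^ p) := by
        refine setLIntegral_mono' measurableSet_Ioo fun t ht => ?_
        have ht0 := ht.1
        have hΓ := Real.Gamma_pos_of_pos (show 0 < 1 - σ by linarith)
        have h1 : ‖J (1 - σ) (derivWithin w (Icc 0 T)) t‖ₑ ≤
            c * (ENNReal.ofReal (t ^ (-σ)) * ‖z t‖ₑ + d * ∫⁻ s in Ioo 0 t,
              ENNReal.ofReal ((t - s) ^ (-σ - 1)) * ‖z t - z s‖ₑ) := by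
          rw [J_derivWithin_eq hT hσ1 hw hw0 ht, enorm_mul, Real.enorm_of_nonneg (by positivity)]
          gcongr
          refine (enorm_add_le _ _).trans ?_
          rw [enorm_mul, enorm_mul, Real.enorm_of_nonneg (by positivity),
            Real.enorm_of_nonneg hσ0.le, hzw t (Ioo_subset_Icc_self ht)]
          gcongr
          refine (enorm_integral_le_lintegral_enorm _).trans_eq ?_
          refine setLIntegral_congr_fun measurableSet_Ioo fun s hs => ?_
          have h : 0 < t - s := sub_pos.2 hs.2
          rw [enorm_mul, Real.enorm_of_nonneg (by positivity),
            hzw s ⟨hs.1.le, hs.2.le.trans ht.2.le⟩]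
        refine (ENNReal.rpow_le_rpow h1 hp0.le).trans ?_
        rw [ENNReal.mul_rpow_of_nonneg _ _ hp0.le, mul_assoc,
          ← ENNReal.mul_rpow_of_nonneg d _ hp0.le]
        gcongr
        exact ENNReal.rpow_add_le_mul_rpow_add_rpow _ _ hp
    _ ≤ c ^ p * 2 ^ (p - 1) * (C * N + d ^ p * (K * N)) := by
        rw [lintegral_const_mul' _ _ hctop, lintegral_add_left (by fun_prop),
          lintegral_const_mul' _ _ hdtop]
        gcongr
        · exact hhardy z hzc hz0
        · exact (lintegral_marchaud_rpow_le hp hσθ hzc).trans (by gcongr; exact le_self_add)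
    _ = _ := by ring

/-! ### Smooth functions with vanishing initial derivatives -/

lemma integrable_of_continuousOn {T : ℝ} {w : ℝ → ℝ} (hw : ContinuousOn w (Icc 0 T)) :
    Integrable w (vol T) :=
  (hw.integrableOn_compact isCompact_Icc).mono_set Ioo_subset_Icc_self

lemma memLp_of_continuousOn {T p : ℝ} {w : ℝ → ℝ} (hw : ContinuousOn w (Icc 0 T)) :
    w ∈ LpSpace T p := by
  obtain ⟨B, hB⟩ := isCompact_Icc.exists_bound_of_continuousOn hw
  refine MemLp.of_bound (integrable_of_continuousOn hw).aestronglyMeasurable B ?_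
  filter_upwards [ae_vol_mem T] with t ht using hB t (Ioo_subset_Icc_self ht)

lemma derivWithin_mem_zeroC {T : ℝ} (hT : 0 < T) {M : ℕ} {v : ℝ → ℝ} (hv : v ∈ zeroC T (M + 1)) :
    derivWithin v (Icc 0 T) ∈ zeroC T M := by
  refine ⟨?_, fun k hk => ?_⟩
  · exact ((contDiffOn_succ_iff_derivWithin (uniqueDiffOn_Icc hT)).1
      (by simpa using hv.1)).2.2
  · rw [← iteratedDerivWithin_succ']
    exact hv.2 (k + 1) (by omega)

lemma eq_J_one_derivWithin {T : ℝ} {v : ℝ → ℝ} (hT : 0 < T)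
    (hv : ContDiffOn ℝ 1 v (Icc 0 T)) (hv0 : v 0 = 0) :
    v =ᵐ[vol T] J 1 (derivWithin v (Icc 0 T)) := by
  filter_upwards [ae_vol_mem T] with t ht
  have hsub : Icc 0 t ⊆ Icc 0 T := Icc_subset_Icc_right ht.2.le
  rw [J_one, ← integral_Ioc_eq_integral_Ioo, ← intervalIntegral.integral_of_le ht.1.le,
    intervalIntegral.integral_eq_sub_of_hasDerivAt_of_le ht.1.le (hv.continuousOn.mono hsub)
      (fun s hs => hasDerivAt_of_contDiffOn hv ⟨hs.1, hs.2.trans ht.2⟩), hv0, sub_zero]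
  have hc := (hv.continuousOn_derivWithin (uniqueDiffOn_Icc hT) le_rfl).mono hsub
  rw [← uIcc_of_le ht.1.le] at hc
  exact hc.intervalIntegrable

lemma zeroC.contDiffOn_one {T : ℝ} {M : ℕ} {v : ℝ → ℝ} (hv : v ∈ zeroC T (M + 1)) :
    ContDiffOn ℝ 1 v (Icc 0 T) :=
  hv.1.of_le (by exact_mod_cast Nat.le_add_left 1 M)

lemma zeroC.eq_zero {T : ℝ} {M : ℕ} {v : ℝ → ℝ} (hv : v ∈ zeroC T (M + 1)) : v 0 = 0 := by
  simpa using hv.2 0 (Nat.succ_pos M)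

lemma zeroC.hasWeakDeriv {T : ℝ} (hT : 0 < T) {j M : ℕ} (hj : j ≤ M) {v : ℝ → ℝ}
    (hv : v ∈ zeroC T M) : HasWeakDeriv T j v (iteratedDerivWithin j v (Icc 0 T)) := by
  induction j generalizing M v with
  | zero => simpa using hasWeakDeriv_zero (integrable_of_continuousOn hv.1.continuousOn)
  | succ j ih =>
    obtain ⟨M, rfl⟩ : ∃ M', M = M' + 1 := ⟨M - 1, by omega⟩
    have h1 := derivWithin_mem_zeroC hT hv
    rw [iteratedDerivWithin_succ']
    exact ((ih (by omega) h1).J_one (integrable_of_continuousOn h1.1.continuousOn)).congr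
      (eq_J_one_derivWithin hT (zeroC.contDiffOn_one hv) (zeroC.eq_zero hv)).symm (ae_eq_refl _)

lemma zeroC.iteratedDerivWithin_mem {T : ℝ} (hT : 0 < T) {j M : ℕ} {v : ℝ → ℝ}
    (hv : v ∈ zeroC T (M + j)) : iteratedDerivWithin j v (Icc 0 T) ∈ zeroC T M := by
  induction j generalizing v with
  | zero => simpa using hv
  | succ j ih =>
    rw [iteratedDerivWithin_succ']
    exact ih (derivWithin_mem_zeroC hT hv)

lemma zeroC.eq_J {T : ℝ} (hT : 0 < T) {j M : ℕ} (hj : 1 ≤ j) (hjM : j ≤ M) {v : ℝ → ℝ}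
    (hv : v ∈ zeroC T M) : v =ᵐ[vol T] J j (iteratedDerivWithin j v (Icc 0 T)) := by
  induction j, hj using Nat.le_induction generalizing M v with
  | base =>
    obtain ⟨M, rfl⟩ : ∃ M', M = M' + 1 := ⟨M - 1, by omega⟩
    rw [show (1 : ℕ) = 0 + 1 from rfl, iteratedDerivWithin_succ', iteratedDerivWithin_zero]
    simpa using eq_J_one_derivWithin hT (zeroC.contDiffOn_one hv) (zeroC.eq_zero hv)
  | succ j hj ih =>
    obtain ⟨M, rfl⟩ : ∃ M', M = M' + 1 := ⟨M - 1, by omega⟩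
    have h1 := derivWithin_mem_zeroC hT hv
    rw [iteratedDerivWithin_succ']
    refine (eq_J_one_derivWithin hT (zeroC.contDiffOn_one hv) (zeroC.eq_zero hv)).trans
      ((J_congr_ae (ih (by omega) h1)).trans ?_)
    have hc : Integrable (iteratedDerivWithin j (derivWithin v (Icc 0 T)) (Icc 0 T)) (vol T) :=
      integrable_of_continuousOn (h1.1.continuousOn_iteratedDerivWithin
        (by exact_mod_cast (by omega : j ≤ M)) (uniqueDiffOn_Icc hT))
    have := J_J_ae (T := T) one_pos (show (0 : ℝ) < j by exact_mod_cast hj) hc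
    rwa [show 1 + (j : ℝ) = (j + 1 : ℕ) by push_cast; ring] at this

lemma zeroC.sub {T : ℝ} (hT : 0 < T) {M : ℕ} {v v' : ℝ → ℝ} (hv : v ∈ zeroC T M)
    (hv' : v' ∈ zeroC T M) : v - v' ∈ zeroC T M := by
  refine ⟨hv.1.sub hv'.1, fun k hk => ?_⟩
  have h0 : (0 : ℝ) ∈ Icc 0 T := left_mem_Icc.2 hT.le
  have hle : ((k : ℕ) : WithTop ℕ∞) ≤ M := by exact_mod_cast hk.le
  rw [iteratedDerivWithin_sub h0 (uniqueDiffOn_Icc hT) ((hv.1 0 h0).of_le hle)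
    ((hv'.1 0 h0).of_le hle), hv.2 k hk, hv'.2 k hk, sub_zero]

/-! ### Slobodecki norms -/

lemma sobolevNorm_le_slobodeckiNorm {T p s : ℝ} (hp : 1 ≤ p) (u : ℝ → ℝ) :
    sobolevNorm T p ⌊s⌋₊ u ≤ slobodeckiNorm T p s u := by
  have hp0 : 0 < p := by linarith
  rw [slobodeckiNorm]
  split_ifs with h
  · exact le_rfl
  · calc sobolevNorm T p ⌊s⌋₊ u = (sobolevNorm T p ⌊s⌋₊ u ^ p) ^ (1 / p) := by
          rw [← ENNReal.rpow_mul, mul_one_div_cancel hp0.ne', ENNReal.rpow_one]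
      _ ≤ _ := by
          gcongr
          exact le_self_add

lemma lpENorm_weakDeriv_le_sobolevNorm {T p : ℝ} {j k : ℕ} (hj : j ≤ k) (u : ℝ → ℝ) :
    lpENorm T p (weakDeriv T j u) ≤ sobolevNorm T p k u :=
  Finset.single_le_sum (f := fun j => lpENorm T p (weakDeriv T j u)) (fun _ _ => zero_le)
    (Finset.mem_range.2 (by omega))

lemma lpENorm_le_slobodeckiNorm {T p s : ℝ} (hp : 1 ≤ p) {u : ℝ → ℝ} (hu : u ∈ LpSpace T p) :
    lpENorm T p u ≤ slobodeckiNorm T p s u := by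
  rw [← lpENorm_congr (hasWeakDeriv_zero (integrable_of_mem hp hu)).weakDeriv_ae]
  exact (lpENorm_weakDeriv_le_sobolevNorm (Nat.zero_le _) u).trans
    (sobolevNorm_le_slobodeckiNorm hp u)

lemma gagliardo_sub_le {T p θ : ℝ} (hp : 1 ≤ p) {v w : ℝ → ℝ}
    (hv : AEStronglyMeasurable v (vol T)) :
    gagliardo T p θ (v - w) ≤ 2 ^ (p - 1) * (gagliardo T p θ v + gagliardo T p θ w) := by
  have hp0 : 0 < p := by linarith
  have hp1 : 0 ≤ p - 1 := by linarith
  have h2 : (2 : ℝ≥0∞) ^ (p - 1) ≠ ⊤ := ENNReal.rpow_ne_top_of_nonneg hp1 (by simp)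
  rw [gagliardo_congr hv.ae_eq_mk,
    gagliardo_congr (show v - w =ᵐ[vol T] hv.mk - w from hv.ae_eq_mk.sub (ae_eq_refl w))]
  set v' := hv.mk with hv'
  have hm : Measurable v' := hv.stronglyMeasurable_mk.measurable
  have hm2 : Measurable fun z : ℝ × ℝ =>
      ENNReal.ofReal (|v' z.2 - v' z.1| ^ p / |z.2 - z.1| ^ (1 + θ * p)) := by fun_prop
  unfold gagliardo
  rw [← lintegral_add_left hm2.lintegral_prod_right', ← lintegral_const_mul' _ _ h2]
  refine lintegral_mono fun s => ?_
  rw [← lintegral_add_left (by fun_prop), ← lintegral_const_mul' _ _ h2]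
  refine lintegral_mono fun t => ?_
  simp only [Pi.sub_apply]
  have hsplit : ∀ a : ℝ, ENNReal.ofReal (|a| ^ p / |t - s| ^ (1 + θ * p)) =
      ‖a‖ₑ ^ p * ENNReal.ofReal ((|t - s| ^ (1 + θ * p))⁻¹) := fun a => by
    rw [div_eq_mul_inv, ENNReal.ofReal_mul (by positivity), ofReal_abs_rpow hp0.le]
  rw [hsplit, hsplit, hsplit, ← add_mul, ← mul_assoc]
  gcongr
  refine (ENNReal.rpow_le_rpow ?_ hp0.le).trans (ENNReal.rpow_add_le_mul_rpow_add_rpow _ _ hp)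
  rw [show v' t - w t - (v' s - w s) = (v' t - v' s) - (w t - w s) by ring]
  exact enorm_sub_le

lemma sobolevNorm_sub_le {T p : ℝ} (hp : 1 ≤ p) {k : ℕ} {u v : ℝ → ℝ}
    (hu : ∀ j ≤ k, WeakDerivInLp T p j u) (hv : ∀ j ≤ k, WeakDerivInLp T p j v) :
    sobolevNorm T p k (u - v) ≤ sobolevNorm T p k u + sobolevNorm T p k v := by
  unfold sobolevNorm
  rw [← Finset.sum_add_distrib]
  refine Finset.sum_le_sum fun j hj => ?_
  have hjk : j ≤ k := Nat.lt_succ_iff.1 (Finset.mem_range.1 hj)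
  obtain ⟨g, hg, hgp⟩ := hu j hjk
  obtain ⟨h, hh, hhp⟩ := hv j hjk
  rw [lpENorm_congr (hg.sub hh).weakDeriv_ae, lpENorm_congr hg.weakDeriv_ae,
    lpENorm_congr hh.weakDeriv_ae]
  exact eLpNorm_sub_le hgp.1 hhp.1 (one_le_ofReal hp)

/-- A triangle inequality up to the factor `2`, which suffices for limits. -/
lemma slobodeckiNorm_sub_le {T p s : ℝ} (hp : 1 ≤ p) {u v : ℝ → ℝ}
    (hu : ∀ j ≤ ⌊s⌋₊, WeakDerivInLp T p j u) (hv : ∀ j ≤ ⌊s⌋₊, WeakDerivInLp T p j v) :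
    slobodeckiNorm T p s (u - v) ≤ 2 * (slobodeckiNorm T p s u + slobodeckiNorm T p s v) := by
  have hp0 : 0 < p := by linarith
  have hp1 : 0 ≤ p - 1 := by linarith
  have hS := sobolevNorm_sub_le hp hu hv
  unfold slobodeckiNorm
  split_ifs with h
  · exact hS.trans (le_mul_of_one_le_left zero_le (by norm_num))
  set k := ⌊s⌋₊
  set θ := s - k
  obtain ⟨g, hg, hgp⟩ := hu k le_rfl
  obtain ⟨g', hg', _⟩ := hv k le_rfl
  have hG : gagliardo T p θ (weakDeriv T k (u - v)) ≤ 2 ^ (p - 1) *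
      (gagliardo T p θ (weakDeriv T k u) + gagliardo T p θ (weakDeriv T k v)) := by
    rw [gagliardo_congr (hg.sub hg').weakDeriv_ae, gagliardo_congr hg.weakDeriv_ae,
      gagliardo_congr hg'.weakDeriv_ae]
    exact gagliardo_sub_le hp hgp.1
  set a := sobolevNorm T p k u
  set b := sobolevNorm T p k v
  set x := gagliardo T p θ (weakDeriv T k u)
  set y := gagliardo T p θ (weakDeriv T k v)
  calc (sobolevNorm T p k (u - v) ^ p + gagliardo T p θ (weakDeriv T k (u - v))) ^ (1 / p)
      ≤ ((a + b) ^ p + 2 ^ (p - 1) * (x + y)) ^ (1 / p) := by gcongr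
    _ ≤ (2 ^ (p - 1) * (a ^ p + b ^ p) + 2 ^ (p - 1) * (x + y)) ^ (1 / p) := by
        gcongr
        exact ENNReal.rpow_add_le_mul_rpow_add_rpow _ _ hp
    _ = (2 ^ (p - 1)) ^ (1 / p) * ((a ^ p + x) + (b ^ p + y)) ^ (1 / p) := by
        rw [← ENNReal.mul_rpow_of_nonneg _ _ (by positivity)]
        congr 1
        ring
    _ ≤ 2 * ((a ^ p + x) ^ (1 / p) + (b ^ p + y) ^ (1 / p)) := by
        gcongr
        · rw [← ENNReal.rpow_mul]
          calc (2 : ℝ≥0∞) ^ ((p - 1) * (1 / p)) ≤ 2 ^ (1 : ℝ) := by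
                refine ENNReal.rpow_le_rpow_of_exponent_le (by norm_num) ?_
                rw [mul_one_div, div_le_one hp0]
                linarith
            _ = 2 := ENNReal.rpow_one _
        · exact ENNReal.rpow_add_le_add_rpow _ _ (by positivity)
            (by rw [div_le_one hp0]; exact hp)


/-! ### Fractional derivatives of functions in the closure -/

/-- The a priori estimate: for `v ∈ ₀C^⌈s⌉` the fractional derivative `J^(m - α) v^(m)` of order
`α < s` is controlled in `L^p` by the norm of `v` in `W^{s,p}`. -/
lemma exists_lpENorm_fracDeriv_le {T p σ α s : ℝ} {m : ℕ} (hT : 0 < T) (hp : 1 ≤ p) (hm : 1 ≤ m)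
    (hσ0 : 0 < σ) (hσ1 : σ < 1) (hα : α = (m : ℝ) - 1 + σ) (hαs : α < s) :
    ∃ C : ℝ≥0∞, C ≠ ⊤ ∧ ∀ v ∈ zeroC T ⌈s⌉₊,
      lpENorm T p (J (m - α) (iteratedDerivWithin m v (Icc 0 T))) ≤
        C * slobodeckiNorm T p s v := by
  have hp0 : 0 < p := by linarith
  obtain ⟨k, rfl⟩ : ∃ k, m = k + 1 := ⟨m - 1, by omega⟩
  push_cast at hα ⊢
  have hks : (k : ℝ) < s := by linarith
  have hkc : k + 1 ≤ ⌈s⌉₊ := Nat.lt_ceil.2 hks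
  have hkf : k ≤ ⌊s⌋₊ := Nat.le_floor hks.le
  rcases hkf.eq_or_lt with hf | hf
  · have hαθ : (k : ℝ) + 1 - α = 1 - σ := by rw [hα]; ring
    obtain ⟨C, hC, hle⟩ := exists_lpENorm_J_derivWithin_le hT hp hσ0 hσ1
      (show σ < s - k by linarith)
    refine ⟨C ^ (1 / p), ENNReal.rpow_ne_top_of_nonneg (by positivity) hC, fun v hv => ?_⟩
    have hw : iteratedDerivWithin k v (Icc 0 T) ∈ zeroC T ((⌈s⌉₊ - k - 1) + 1) := by
      refine zeroC.iteratedDerivWithin_mem hT ?_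
      rwa [show ⌈s⌉₊ - k - 1 + 1 + k = ⌈s⌉₊ by omega]
    have hwd := (zeroC.hasWeakDeriv hT (show k ≤ ⌈s⌉₊ by omega) hv).weakDeriv_ae
    have hV : iteratedDerivWithin (k + 1) v (Icc 0 T) =
        derivWithin (iteratedDerivWithin k v (Icc 0 T)) (Icc 0 T) := iteratedDerivWithin_succ
    have h1 := hle _ (zeroC.contDiffOn_one hw) (zeroC.eq_zero hw)
    have hns : s ≠ (⌊s⌋₊ : ℝ) := by rw [← hf]; exact hks.ne'
    rw [hαθ, hV, ← ENNReal.rpow_le_rpow_iff hp0, ENNReal.mul_rpow_of_nonneg _ _ hp0.le,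
      slobodeckiNorm, if_neg hns, ← ENNReal.rpow_mul, ← ENNReal.rpow_mul,
      one_div_mul_cancel hp0.ne', ENNReal.rpow_one, ENNReal.rpow_one, ← hf]
    refine h1.trans ?_
    rw [← gagliardo_congr hwd, ← lpENorm_congr hwd, add_comm]
    gcongr
    exact lpENorm_weakDeriv_le_sobolevNorm le_rfl v
  · have hpos : 0 < (k : ℝ) + 1 - α := by linarith
    refine ⟨ENNReal.ofReal (T ^ ((k : ℝ) + 1 - α) / Real.Gamma ((k : ℝ) + 1 - α + 1)),
      ENNReal.ofReal_ne_top, fun v hv => ?_⟩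
    have hc : ContinuousOn (iteratedDerivWithin (k + 1) v (Icc 0 T)) (Icc 0 T) :=
      hv.1.continuousOn_iteratedDerivWithin (by exact_mod_cast hkc) (uniqueDiffOn_Icc hT)
    refine (lpENorm_J_le hT.le hpos hp
      (integrable_of_continuousOn hc).aestronglyMeasurable).trans ?_
    gcongr
    rw [← lpENorm_congr (zeroC.hasWeakDeriv hT hkc hv).weakDeriv_ae]
    exact (lpENorm_weakDeriv_le_sobolevNorm (show k + 1 ≤ ⌊s⌋₊ from hf) v).trans
      (sobolevNorm_le_slobodeckiNorm hp v)

/-- The inclusion `₀W^{s,p} ⊆ W_{α,p}` for `α < s`: the fractional derivatives of an approximating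
sequence converge in `L^p`. -/
lemma zeroW_subset_fracW {T p σ α s : ℝ} {m : ℕ} (hT : 0 < T) (hp : 1 ≤ p) (hm : 1 ≤ m)
    (hσ0 : 0 < σ) (hσ1 : σ < 1) (hα : α = (m : ℝ) - 1 + σ) (hαs : α < s) :
    zeroW T p s ⊆ fracW T p α := by
  rintro u ⟨huW, hu⟩
  have hm1 : (1 : ℝ) ≤ m := by exact_mod_cast hm
  have hα0 : 0 < α := by linarith
  have hmα : 0 < (m : ℝ) - α := by linarith
  have hmc : m ≤ ⌈s⌉₊ := by
    obtain ⟨k, rfl⟩ : ∃ k, m = k + 1 := ⟨m - 1, by omega⟩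
    push_cast at hα
    exact Nat.lt_ceil.2 (show (k : ℝ) < s by linarith)
  obtain ⟨C, hC, hest⟩ := exists_lpENorm_fracDeriv_le hT hp hm hσ0 hσ1 hα hαs
  have hhalf : ∀ n : ℕ, (0 : ℝ≥0∞) < 2⁻¹ ^ n := fun n =>
    ENNReal.pow_pos (by simp) n
  choose v hv hvW hvu using fun n : ℕ => hu (2⁻¹ ^ n) (hhalf n)
  have hVc : ∀ n, ContinuousOn (iteratedDerivWithin m (v n) (Icc 0 T)) (Icc 0 T) := fun n =>
    (hv n).1.continuousOn_iteratedDerivWithin (by exact_mod_cast hmc) (uniqueDiffOn_Icc hT)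
  set f : ℕ → ℝ → ℝ := fun n => J (m - α) (iteratedDerivWithin m (v n) (Icc 0 T)) with hf
  have hfp : ∀ n, f n ∈ LpSpace T p := fun n =>
    J_mem hT.le hmα hp (memLp_of_continuousOn (hVc n))
  have hJf : ∀ n, J α (f n) =ᵐ[vol T] v n := fun n => by
    have h1 := J_J_ae hα0 hmα (integrable_of_continuousOn (hVc n))
    rw [add_sub_cancel] at h1
    exact h1.trans (zeroC.eq_J hT hm hmc (hv n)).symm
  have hcau : ∀ N i j : ℕ, N ≤ i → N ≤ j →
      eLpNorm (f i - f j) (ENNReal.ofReal p) (vol T) < (C * 4 + 1) * 2⁻¹ ^ N := by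
    intro N i j hi hj
    have h1 : f i - f j =ᵐ[vol T]
        J (m - α) (iteratedDerivWithin m (v i - v j) (Icc 0 T)) := by
      refine (J_sub_ae hmα (integrable_of_continuousOn (hVc i))
        (integrable_of_continuousOn (hVc j))).symm.trans (J_congr_ae ?_)
      filter_upwards [ae_vol_mem T] with t ht
      have htI := Ioo_subset_Icc_self ht
      have hle : ((m : ℕ) : WithTop ℕ∞) ≤ (⌈s⌉₊ : ℕ) := by exact_mod_cast hmc
      rw [iteratedDerivWithin_sub htI (uniqueDiffOn_Icc hT) (((hv i).1 t htI).of_le hle)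
        (((hv j).1 t htI).of_le hle), Pi.sub_apply]
    have hsub : ∀ n, ∀ l ≤ ⌊s⌋₊, WeakDerivInLp T p l (u - v n) := fun n l hl => by
      obtain ⟨g, hg, hgp⟩ := huW.2.1 l hl
      obtain ⟨h, hh, hhp⟩ := (hvW n).2.1 l hl
      exact ⟨g - h, hg.sub hh, MemLp.sub hgp hhp⟩
    have hpow : ∀ n, N ≤ n → slobodeckiNorm T p s (u - v n) ≤ 2⁻¹ ^ N := fun n hn =>
      (hvu n).le.trans (pow_le_pow_right_of_le_one' (by norm_num) hn)
    calc eLpNorm (f i - f j) (ENNReal.ofReal p) (vol T)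
        = lpENorm T p (J (m - α) (iteratedDerivWithin m (v i - v j) (Icc 0 T))) :=
          eLpNorm_congr_ae h1
      _ ≤ C * slobodeckiNorm T p s (v i - v j) := hest _ (zeroC.sub hT (hv i) (hv j))
      _ = C * slobodeckiNorm T p s ((u - v j) - (u - v i)) := by rw [sub_sub_sub_cancel_left]
      _ ≤ C * (2 * (2⁻¹ ^ N + 2⁻¹ ^ N)) := by
          gcongr
          refine (slobodeckiNorm_sub_le hp (hsub j) (hsub i)).trans ?_
          gcongr
          · exact hpow j hj
          · exact hpow i hi
      _ = C * 4 * 2⁻¹ ^ N := by ring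
      _ < (C * 4 + 1) * 2⁻¹ ^ N := by
          rw [add_mul, one_mul]
          refine ENNReal.lt_add_right ?_ (hhalf N).ne'
          exact ENNReal.mul_ne_top (ENNReal.mul_ne_top hC (by simp)) (by simp)
  have hsum : ∑' N : ℕ, (C * 4 + 1) * 2⁻¹ ^ N ≠ ⊤ := by
    rw [ENNReal.tsum_mul_left, ENNReal.tsum_geometric, ENNReal.one_sub_inv_two, inv_inv]
    exact ENNReal.mul_ne_top (ENNReal.add_ne_top.2
      ⟨ENNReal.mul_ne_top hC (by simp), by simp⟩) (by simp)
  obtain ⟨g, hg, hlim⟩ := Lp.cauchy_complete_eLpNorm (one_le_ofReal hp) hfp hsum hcau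
  refine ⟨g, hg, ?_⟩
  -- `u` and `J^α g` are both limits of `v n` in `L^p`
  have hbound : ∀ n, lpENorm T p (u - J α g) ≤ 2⁻¹ ^ n +
      ENNReal.ofReal (T ^ α / Real.Gamma (α + 1)) *
        eLpNorm (f n - g) (ENNReal.ofReal p) (vol T) := by
    intro n
    have hun : u - v n ∈ LpSpace T p := MemLp.sub huW.1 (hvW n).1
    have h1 : u - J α g =ᵐ[vol T] (u - v n) + J α (f n - g) := by
      filter_upwards [hJf n, J_sub_ae hα0 (integrable_of_mem hp (hfp n))
        (integrable_of_mem hp hg)] with t h2 h3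
      simp only [Pi.sub_apply, Pi.add_apply] at h3 ⊢
      rw [h3, h2]
      ring
    have hfg : f n - g ∈ LpSpace T p := MemLp.sub (hfp n) hg
    rw [lpENorm_congr h1]
    refine (eLpNorm_add_le hun.1 (J_mem hT.le hα0 hp hfg).1 (one_le_ofReal hp)).trans
      (add_le_add ?_ (lpENorm_J_le hT.le hα0 hp hfg.1))
    exact (lpENorm_le_slobodeckiNorm hp hun).trans (hvu n).le
  have hz : lpENorm T p (u - J α g) = 0 := by
    have h1 : Tendsto (fun n : ℕ => (2⁻¹ : ℝ≥0∞) ^ n + ENNReal.ofReal (T ^ α / Real.Gamma (α + 1)) *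
        eLpNorm (f n - g) (ENNReal.ofReal p) (vol T)) atTop (𝓝 (0 + ENNReal.ofReal
          (T ^ α / Real.Gamma (α + 1)) * 0)) :=
      (ENNReal.tendsto_pow_atTop_nhds_zero_of_lt_one (by norm_num)).add
        (ENNReal.Tendsto.const_mul hlim (Or.inr ENNReal.ofReal_ne_top))
    rw [mul_zero, add_zero] at h1
    exact le_antisymm (ge_of_tendsto' h1 hbound) zero_le
  have hp0 : ENNReal.ofReal p ≠ 0 := by
    have := one_le_ofReal hp
    exact (lt_of_lt_of_le one_pos this).ne'
  have hsm : u - J α g ∈ LpSpace T p := MemLp.sub huW.1 (J_mem hT.le hα0 hp hg)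
  have := (eLpNorm_eq_zero_iff hsm.1 hp0).1 hz
  filter_upwards [this] with t ht
  exact sub_eq_zero.1 ht

/-- On `W_{α,p}` the operator `D^m J^(m - α)` inverts `J^α`, since `J^(m - α) J^α = J^m`. -/
lemma fracW.weakDeriv_J {T p α : ℝ} {m : ℕ} (hp : 1 ≤ p) (hm : 1 ≤ m)
    (hα0 : 0 < α) (hαm : α < m) {u : ℝ → ℝ} (hu : u ∈ fracW T p α) :
    WeakDerivInLp T p m (J (m - α) u) ∧ J α (weakDeriv T m (J (m - α) u)) =ᵐ[vol T] u := by
  obtain ⟨f, hf, huf⟩ := hu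
  have hfi := integrable_of_mem hp hf
  have h1 : J (m - α) u =ᵐ[vol T] J m f := by
    have h2 := J_J_ae (sub_pos.2 hαm) hα0 hfi
    rw [sub_add_cancel] at h2
    exact (J_congr_ae huf).trans h2
  have h3 : HasWeakDeriv T m (J (m - α) u) f :=
    (hasWeakDeriv_J_nat hfi hm).congr h1.symm (ae_eq_refl _)
  exact ⟨⟨f, h3, hf⟩, (J_congr_ae h3.weakDeriv_ae).trans huf.symm⟩


/-! ### Compactness of the fractional integral -/

lemma integrable_mul_translate {k z : ℝ → ℝ} (hkc : HasCompactSupport k) (hk : Continuous k)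
    (hz : Integrable z) (t : ℝ) : Integrable fun s => k (t - s) * z s := by
  obtain ⟨B, hB⟩ := hkc.exists_bound_of_continuous hk
  exact hz.bdd_mul (by fun_prop) (Eventually.of_forall fun s => hB (t - s))

/-- The convolutions of a bounded family in `L^1` with a continuous kernel are uniformly close to
finitely many of them, by the Arzelà–Ascoli theorem. -/
lemma exists_finite_net_convolution {k : ℝ → ℝ} (hkc : HasCompactSupport k) (hk : Continuous k)
    {z : ℕ → ℝ → ℝ} (hz : ∀ n, Integrable (z n)) {R : ℝ} (hR : ∀ n, ∫ s, ‖z n s‖ ≤ R) (T : ℝ)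
    {δ : ℝ} (hδ : 0 < δ) :
    ∃ I : Set ℕ, I.Finite ∧ ∀ n, ∃ i ∈ I, ∀ t ∈ Icc 0 T,
      ‖(∫ s, k (t - s) * z n s) - ∫ s, k (t - s) * z i s‖ ≤ δ := by
  obtain ⟨B, hB⟩ := hkc.exists_bound_of_continuous hk
  have hB0 : 0 ≤ B := (norm_nonneg _).trans (hB 0)
  have hR0 : 0 ≤ R := (integral_nonneg fun _ => norm_nonneg _).trans (hR 0)
  set Y : ℕ → ℝ → ℝ := fun n t => ∫ s, k (t - s) * z n s with hY
  have hbound : ∀ n t, ‖Y n t‖ ≤ B * R := by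
    intro n t
    refine (norm_integral_le_of_norm_le ((hz n).norm.const_mul B)
      (Eventually.of_forall fun s => ?_)).trans ?_
    · rw [norm_mul]
      gcongr
      exact hB _
    · rw [integral_const_mul]
      exact mul_le_mul_of_nonneg_left (hR n) hB0
  have hmod : ∀ e > 0, ∃ d > 0, ∀ t t', dist t t' < d → ∀ n, dist (Y n t) (Y n t') < e := by
    intro e he
    obtain ⟨d, hd, hkd⟩ := Metric.uniformContinuous_iff.1
      (hkc.uniformContinuous_of_continuous hk) (e / (R + 1)) (by positivity)
    refine ⟨d, hd, fun t t' htt n => ?_⟩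
    rw [dist_eq_norm, hY]
    simp only
    rw [← integral_sub (integrable_mul_translate hkc hk (hz n) t)
      (integrable_mul_translate hkc hk (hz n) t')]
    calc ‖∫ s, (k (t - s) * z n s - k (t' - s) * z n s)‖ ≤ ∫ s, e / (R + 1) * ‖z n s‖ := by
          refine norm_integral_le_of_norm_le ((hz n).norm.const_mul _)
            (Eventually.of_forall fun s => ?_)
          rw [← sub_mul, norm_mul, ← dist_eq_norm]
          gcongr
          exact (hkd (by simpa using htt)).le
      _ ≤ e / (R + 1) * R := by
          rw [integral_const_mul]
          exact mul_le_mul_of_nonneg_left (hR n) (by positivity)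
      _ < e := by
          rw [div_mul_eq_mul_div, div_lt_iff₀ (by positivity)]
          nlinarith
  have hcont : ∀ n, Continuous (Y n) := fun n => by
    rw [Metric.continuous_iff]
    intro t e he
    obtain ⟨d, hd, h⟩ := hmod e he
    exact ⟨d, hd, fun t' ht' => h t' t ht' n⟩
  set F : ℕ → BoundedContinuousFunction (Icc (0 : ℝ) T) ℝ := fun n =>
    BoundedContinuousFunction.mkOfCompact ⟨fun t => Y n t, (hcont n).comp continuous_subtype_val⟩
    with hF
  have hcomp : IsCompact (closure (range F)) := by
    refine BoundedContinuousFunction.arzela_ascoli (Metric.closedBall 0 (B * R))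
      (isCompact_closedBall _ _) (range F) ?_ ?_
    · rintro _ t ⟨n, rfl⟩
      rw [mem_closedBall_zero_iff]
      exact hbound n t
    · refine UniformEquicontinuous.equicontinuous (Metric.uniformEquicontinuous_iff.2 ?_)
      intro e he
      obtain ⟨d, hd, h⟩ := hmod e he
      refine ⟨d, hd, ?_⟩
      rintro t t' htt ⟨_, n, rfl⟩
      exact h t t' htt n
  obtain ⟨S, hS, hSf, hcov⟩ := Metric.finite_approx_of_totallyBounded
    (hcomp.totallyBounded.subset subset_closure) δ hδ
  have hS' : ∀ y ∈ S, ∃ n, F n = y := fun y hy => hS hy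
  choose! g hg using hS'
  refine ⟨g '' S, hSf.image g, fun n => ?_⟩
  obtain ⟨y, hy, hny⟩ := mem_iUnion₂.1 (hcov (mem_range_self n))
  rw [← hg y hy] at hny
  refine ⟨g y, mem_image_of_mem g hy, fun t ht => ?_⟩
  have h1 := (BoundedContinuousFunction.dist_coe_le_dist (f := F n) (g := F (g y)) ⟨t, ht⟩).trans
    (Metric.mem_ball.1 hny).le
  rwa [dist_eq_norm] at h1

lemma lpENorm_J_sub_convolution_le {T p β : ℝ} (hβ : 0 < β) (hp : 1 ≤ p) {k w : ℝ → ℝ}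
    (hkc : HasCompactSupport k) (hk : Continuous k) (hw : w ∈ LpSpace T p) :
    lpENorm T p (J β w - fun t => ∫ s, k (t - s) * zext T w s) ≤
      (∫⁻ x, ‖ker T β x - k x‖ₑ) * lpENorm T p w := by
  have hwi := integrable_of_mem hp hw
  refine le_of_eq_of_le (lpENorm_congr ?_) (lpENorm_convolution_le hp
    ((measurable_ker T β).sub hk.measurable) hw.1)
  filter_upwards [ae_vol_mem T, ae_integrable_J hβ hwi] with t ht h1
  have h2 : Integrable fun s => ker T β (t - s) * zext T w s := by
    simp_rw [ker_mul_zext ht.2.le]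
    rw [integrable_indicator_iff measurableSet_Ioo]
    exact h1.const_mul _
  simp only [Pi.sub_apply, sub_mul]
  rw [integral_sub h2 (integrable_mul_translate hkc hk (integrable_zext hwi) t),
    J_eq_integral ht.2.le]

/-- A bounded sequence in `L^p` is mapped by `J^β` to a sequence all of whose members are close to
finitely many of them: the kernel of `J^β` is a limit of continuous kernels in `L^1`. -/
lemma exists_finite_net_J {T p β : ℝ} (hβ : 0 < β) (hp : 1 ≤ p)
    {w : ℕ → ℝ → ℝ} (hw : ∀ n, w n ∈ LpSpace T p) {R : ℝ≥0} (hR : ∀ n, lpENorm T p (w n) ≤ R)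
    {δ : ℝ≥0∞} (hδ : 0 < δ) :
    ∃ I : Set ℕ, I.Finite ∧ ∀ n, ∃ i ∈ I, lpENorm T p (J β (w n) - J β (w i)) < δ := by
  have hp0 : 0 < p := by linarith
  obtain ⟨η, hη0, hηδ⟩ := ENNReal.lt_iff_exists_nnreal_btwn.1 hδ
  have hη : 0 < η := by exact_mod_cast hη0
  have hwi := fun n => integrable_of_mem hp (hw n)
  -- an `L^1` bound for the sequence
  obtain ⟨R₁, hR₁⟩ : ∃ R₁ : ℝ, ∀ n, ∫ s, ‖zext T (w n) s‖ ≤ R₁ := by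
    refine ⟨(R * vol T univ ^ (1 / (1 : ℝ≥0∞).toReal - 1 / (ENNReal.ofReal p).toReal)).toReal,
      fun n => ?_⟩
    rw [integral_norm_eq_lintegral_enorm (integrable_zext (hwi n)).aestronglyMeasurable]
    refine ENNReal.toReal_mono (ENNReal.mul_ne_top (by simp) ?_) ?_
    · refine ENNReal.rpow_ne_top_of_nonneg ?_ (measure_ne_top _ _)
      rw [ENNReal.toReal_ofReal hp0.le, ENNReal.toReal_one, sub_nonneg, div_le_div_iff₀ hp0 one_pos]
      linarith
    · have h1 : ∫⁻ s, ‖zext T (w n) s‖ₑ = eLpNorm (w n) 1 (vol T) := by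
        have := lintegral_zext_rpow (T := T) le_rfl (w n)
        simpa [lpENorm] using this
      rw [h1]
      refine (eLpNorm_le_eLpNorm_mul_rpow_measure_univ (one_le_ofReal hp) (hw n).1).trans ?_
      gcongr
      exact hR n
  set e : ℝ≥0 := η / 3 / (R + 1) with he
  have he0 : (e : ℝ≥0∞) ≠ 0 := by
    have : 0 < e := by positivity
    exact_mod_cast this.ne'
  obtain ⟨k, hkc, hke, hk, -⟩ :=
    (integrable_ker (T := T) hβ).exists_hasCompactSupport_lintegral_sub_le he0
  have hT0 : (0 : ℝ) ≤ (vol T univ ^ p⁻¹).toReal := ENNReal.toReal_nonneg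
  set V := (vol T univ ^ p⁻¹).toReal with hV
  have hVtop : vol T univ ^ p⁻¹ ≠ ⊤ :=
    ENNReal.rpow_ne_top_of_nonneg (by positivity) (measure_ne_top _ _)
  obtain ⟨I, hI, hnet⟩ := exists_finite_net_convolution hkc hk (fun n => integrable_zext (hwi n))
    hR₁ T (show (0 : ℝ) < η / 3 / (V + 1) by positivity)
  refine ⟨I, hI, fun n => ?_⟩
  obtain ⟨i, hi, hni⟩ := hnet n
  refine ⟨i, hi, lt_of_le_of_lt ?_ hηδ⟩
  set c : ℕ → ℝ → ℝ := fun n t => ∫ s, k (t - s) * zext T (w n) s with hc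
  have hclose : ∀ n, lpENorm T p (J β (w n) - c n) ≤ (η / 3 : ℝ≥0) := by
    intro n
    refine (lpENorm_J_sub_convolution_le hβ hp hkc hk (hw n)).trans ?_
    calc (∫⁻ x, ‖ker T β x - k x‖ₑ) * lpENorm T p (w n) ≤ e * R := by
          gcongr
          exact hR n
      _ ≤ ((η / 3 : ℝ≥0) : ℝ≥0∞) := by
          rw [← ENNReal.coe_mul, ENNReal.coe_le_coe, he, div_mul_eq_mul_div,
            div_le_iff₀ (by positivity)]
          gcongr
          simp
  have hcm : ∀ n, AEStronglyMeasurable (c n) (vol T) := by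
    intro n
    have h1 : Continuous (convolution k (zext T (w n)) (ContinuousLinearMap.mul ℝ ℝ) volume) :=
      hkc.continuous_convolution_left _ hk (integrable_zext (hwi n)).locallyIntegrable
    have h2 : c n = convolution k (zext T (w n)) (ContinuousLinearMap.mul ℝ ℝ) volume := by
      ext t
      rw [convolution_mul_swap]
    rw [h2]
    exact h1.aestronglyMeasurable
  have hJm : ∀ n, AEStronglyMeasurable (J β (w n)) (vol T) := fun n =>
    (integrable_J hβ (hwi n)).aestronglyMeasurable
  have hmid : lpENorm T p (c n - c i) ≤ (η / 3 : ℝ≥0) := by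
    have h1 : ∀ᵐ t ∂(vol T), ‖(c n - c i) t‖ ≤ η / 3 / (V + 1) := by
      filter_upwards [ae_vol_mem T] with t ht using hni t (Ioo_subset_Icc_self ht)
    refine (eLpNorm_le_of_ae_bound h1).trans ?_
    rw [ENNReal.toReal_ofReal hp0.le, ← ENNReal.ofReal_toReal hVtop, ← hV,
      ← ENNReal.ofReal_mul hT0, ← ENNReal.ofReal_coe_nnreal]
    apply ENNReal.ofReal_le_ofReal
    push_cast
    rw [← mul_div_assoc, div_le_iff₀ (by positivity)]
    nlinarith [show (0 : ℝ) ≤ η / 3 by positivity]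
  have hsplit : J β (w n) - J β (w i) =
      ((J β (w n) - c n) + (c n - c i)) - (J β (w i) - c i) := by
    ext t
    simp only [Pi.sub_apply, Pi.add_apply]
    ring
  rw [hsplit]
  calc lpENorm T p (((J β (w n) - c n) + (c n - c i)) - (J β (w i) - c i))
      ≤ lpENorm T p ((J β (w n) - c n) + (c n - c i)) + lpENorm T p (J β (w i) - c i) :=
        eLpNorm_sub_le (((hJm n).sub (hcm n)).add ((hcm n).sub (hcm i)))
          ((hJm i).sub (hcm i)) (one_le_ofReal hp)
    _ ≤ (lpENorm T p (J β (w n) - c n) + lpENorm T p (c n - c i)) +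
          lpENorm T p (J β (w i) - c i) := by
        gcongr
        exact eLpNorm_add_le ((hJm n).sub (hcm n)) ((hcm n).sub (hcm i)) (one_le_ofReal hp)
    _ ≤ ((η / 3 : ℝ≥0) + (η / 3 : ℝ≥0)) + (η / 3 : ℝ≥0) :=
        add_le_add (add_le_add (hclose n) hmid) (hclose i)
    _ = η := by
        rw [← ENNReal.coe_add, ← ENNReal.coe_add]
        congr 1
        rw [← NNReal.coe_inj]
        push_cast
        ring

/-- `J^β` maps bounded sequences in `L^p` to sequences with a convergent subsequence. -/
lemma exists_subseq_tendsto_J {T p β : ℝ} (hT : 0 < T) (hβ : 0 < β) (hp : 1 ≤ p)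
    {w : ℕ → ℝ → ℝ} (hw : ∀ n, w n ∈ LpSpace T p) {R : ℝ≥0} (hR : ∀ n, lpENorm T p (w n) ≤ R) :
    ∃ g ∈ LpSpace T p, ∃ φ : ℕ → ℕ, StrictMono φ ∧
      Tendsto (fun k => lpENorm T p (J β (w (φ k)) - g)) atTop (𝓝 0) := by
  have : Fact (1 ≤ ENNReal.ofReal p) := ⟨one_le_ofReal hp⟩
  have hJ : ∀ n, MemLp (J β (w n)) (ENNReal.ofReal p) (vol T) := fun n => J_mem hT.le hβ hp (hw n)
  set x : ℕ → Lp ℝ (ENNReal.ofReal p) (vol T) := fun n => (hJ n).toLp with hx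
  have htb : TotallyBounded (range x) := by
    rw [EMetric.totallyBounded_iff]
    intro δ hδ
    obtain ⟨I, hI, hnet⟩ := exists_finite_net_J hβ hp hw hR hδ
    refine ⟨x '' I, hI.image x, ?_⟩
    rintro _ ⟨n, rfl⟩
    obtain ⟨i, hi, hni⟩ := hnet n
    refine mem_iUnion₂.2 ⟨x i, mem_image_of_mem x hi, ?_⟩
    rw [Metric.mem_eball, hx, Lp.edist_toLp_toLp]
    exact hni
  have hcomp : IsCompact (closure (range x)) :=
    htb.closure.isCompact_of_isClosed isClosed_closure
  obtain ⟨a, -, φ, hφ, hlim⟩ := hcomp.tendsto_subseq fun n => subset_closure (mem_range_self n)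
  refine ⟨a, Lp.memLp a, φ, hφ, ?_⟩
  have h1 := (Lp.tendsto_Lp_iff_tendsto_eLpNorm'' (fun k => J β (w (φ k))) (fun k => hJ (φ k)) a
    (Lp.memLp a)).1 (by rw [Lp.toLp_coeFn]; exact hlim)
  exact h1

/-- The embedding of `W_{α + ε,p}` in `W_{α,p}` is compact: in terms of the inverses of the
fractional integrals it is the operator `J^ε` on `L^p`. -/
lemma compactEmbedding {T p α ε : ℝ} (hT : 0 < T) (hα : 0 < α) (hε : 0 < ε) (hp : 1 ≤ p) :
    CompactEmbedding T p (α + ε) α := by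
  have hαε : 0 < α + ε := by linarith
  refine ⟨?_, fun u hu hbd => ?_⟩
  · rintro u ⟨w, hw, huw⟩
    exact ⟨J ε w, J_mem hT.le hε hp hw,
      huw.trans (J_J_ae hα hε (integrable_of_mem hp hw)).symm⟩
  obtain ⟨R, hR⟩ := hbd
  choose w hw huw using hu
  have hwR : ∀ n, lpENorm T p (w n) ≤ R := fun n => by
    rw [← lpENorm_congr (Jinv_ae hp hαε (hw n) (huw n))]
    exact hR n
  obtain ⟨g, hg, φ, hφ, hlim⟩ := exists_subseq_tendsto_J hT hε hp hw hwR
  refine ⟨J α g, ⟨g, hg, ae_eq_refl _⟩, φ, hφ, ?_⟩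
  refine hlim.congr fun k => ?_
  have hJw : J ε (w (φ k)) ∈ LpSpace T p := J_mem hT.le hε hp (hw _)
  have h1 : u (φ k) - J α g =ᵐ[vol T] J α (J ε (w (φ k)) - g) := by
    filter_upwards [huw (φ k), J_J_ae hα hε (integrable_of_mem hp (hw (φ k))),
      J_sub_ae hα (integrable_of_mem hp hJw) (integrable_of_mem hp hg)] with t h1 h2 h3
    rw [h3, Pi.sub_apply, Pi.sub_apply, h2, h1]
  exact (lpENorm_congr (Jinv_ae hp hα (MemLp.sub hJw hg) h1)).symm

end FracSobolev

end

theorem theorem2p1 (T : ℝ) (hT : 0 < T) (m : ℕ) (hm : 1 ≤ m) (σ α ε : ℝ)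
    (hσ0 : 0 < σ) (hσ1 : σ < 1) (hα : α = (m : ℝ) - 1 + σ) (hε : 0 < ε) (hεα : ε < α) :
    -- (i), the estimate, with a constant that depends neither on `p` nor on `v`
    (∃ C : ℝ, 0 < C ∧ ∀ p : ℝ, 1 ≤ p → ∀ v ∈ FracSobolev.LpSpace T p,
      FracSobolev.J α v ∈ FracSobolev.W T p (α - ε) ∧
      FracSobolev.slobodeckiNorm T p (α - ε) (FracSobolev.J α v) ≤
        ENNReal.ofReal C * FracSobolev.lpENorm T p v) ∧
    ∀ p : ℝ, 1 ≤ p →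
      -- (i), the inclusion
      FracSobolev.fracW T p α ⊆ FracSobolev.zeroW T p (α - ε) ∧
      -- (ii)
      FracSobolev.zeroW T p (α + ε) ⊆ FracSobolev.fracW T p α ∧
      (∀ u ∈ FracSobolev.zeroW T p (α + ε),
        FracSobolev.WeakDerivInLp T p m (FracSobolev.J (m - α) u) ∧
        FracSobolev.J α (FracSobolev.weakDeriv T m (FracSobolev.J (m - α) u))
          =ᵐ[FracSobolev.vol T] u) ∧
      -- (iii)
      FracSobolev.CompactEmbedding T p (α + ε) α := by
  have hs0 : 0 < α - ε := sub_pos.2 hεα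
  have hα0 : 0 < α := hε.trans hεα
  refine ⟨FracSobolev.exists_slobodeckiNorm_J_le hT hs0 (by linarith), fun p hp => ?_⟩
  have hsub := FracSobolev.zeroW_subset_fracW (s := α + ε) hT hp hm hσ0 hσ1 hα (by linarith)
  exact ⟨FracSobolev.fracW_subset_zeroW hT hp hs0 (by linarith), hsub,
    fun u hu => FracSobolev.fracW.weakDeriv_J hp hm hα0 (by linarith) (hsub hu),
    FracSobolev.compactEmbedding hT hα0 hε hp⟩
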